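/- **Setting.** Let $F$ be a non-archimedean local field with valuation ring $\mathcal O$, uniformizer $\varpi$ and residue field of order $q$, and let $\Gamma\subset G={\rm PGL}_3(F)$ be a discrete, cocompact, torsion-free subgroup. Let $X$ be the Bruhat–Tits building of $G$. Its vertices are the homothety classes of $\mathcal O$-lattices in $F^3$; two distinct vertices $x,y$ are joined by an edge if they have representatives $\Lambda_1,\Lambda_2$ with $\varpi\Lambda_1\subset\Lambda_2\subset\Lambda_1$. A vertex has type $j\in\mathbb Z/3$ if it lies in the orbit of $[L_j]$ under the image of ${\rm SL}_3(F)$ in $G$, where $L_0=\mathcal O e_1\oplus\mathcal O e_2\oplus\mathcal O e_3$, $L_1=\mathcal O e_1\oplus\mathcal O e_2\oplus\varpi\mathcal O e_3$, $L_2=\mathcal O e_1\oplus\varpi\mathcal O e_2\oplus\varpi\mathcal O e_3$. An oriented edge $(x,y)$ is positively oriented if the type of $y$ is that of $x$ plus $1$ modulo $3$; the action of $G$ preserves this orientation. A rank-one geodesic in $X$ is a straight oriented line in an apartment that runs along edges; it is regarded as a bi-infinite sequence of oriented edges. A closed rank-one geodesic in $\Gamma\backslash X$ is the image of a rank-one geodesic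 of $X$ whose sequence of oriented edges in $\Gamma\backslash X$ is periodic, together with a period $l(c)\ge 1$, its length; it is considered up to the choice of the starting point, and it is primitive if $l(c)$ is the smallest positive period. Let $\mathcal C_1$ be the set of all primitive closed rank-one geodesics in $\Gamma\backslash X$ modulo reversal of orientation, and put $$Z_1(u)=\prod_{c\in\mathcal C_1}\bigl(1-u^{l(c)}\bigr)$$ as a formal power series. Let $E(\Gamma\backslash X)$ be the set of positively oriented edges of $\Gamma\backslash X$ (that is, $\Gamma$-orbits of positively oriented edges of $X$), let $C_1(\Gamma\backslash X)=\bigoplus_{e\in E(\Gamma\backslash X)}\mathbb C e$, and let $T$ be the linear operator on $C_1(\Gamma\backslash X)$ with $Te=\sum_{e'}e'$, where the sum runs over all $e'\in E(\Gamma\backslash X)$ such that $e,e'$ are consecutive edges (in this order) of the image of a rank-one geodesic of $X$. **Theorem.** The quotient $\Gamma\backslash X$ has finitely many vertices and edges, the product defining $Z_1(u)$ converges as a formal power series, and $$Z_1(u)=\det(1-uT).$$ In particular, $Z_1(u)$ is a polynomial of degree equal to the number of edges of $\Gamma\backslash X$, or, equivalently, $$\deg Z_1(u)=(q^2+q+1)\,N,$$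 where $N$ is the number of vertices of $\Gamma\backslash X$. -/

import Mathlib

open scoped MatrixGroups ValuativeRel Polynomial PowerSeries PowerSeries.WithPiTopology

noncomputable section

namespace PGL3Building

section Lattices

variable (F : Type*) [Field F] [ValuativeRel F]

/-- `𝒪`-lattices in `F³`: finitely generated `𝒪`-submodules that span `F³` over `F`. -/
def Lattice : Type _ :=
  {Λ : Submodule 𝒪[F] (Fin 3 → F) // Submodule.IsLattice F Λ}

variable {F}

/-- The linear map `v ↦ g v` of `F³`, regarded as `𝒪`-linear. -/
def glMap (g : GL (Fin 3) F) : (Fin 3 → F) →ₗ[𝒪[F]] (Fin 3 → F) :=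
  (Matrix.mulVecLin (g : Matrix (Fin 3) (Fin 3) F)).restrictScalars 𝒪[F]

theorem glMap_apply (g : GL (Fin 3) F) (v : Fin 3 → F) :
    glMap g v = (g : Matrix (Fin 3) (Fin 3) F).mulVec v := rfl

theorem glMap_one : glMap (1 : GL (Fin 3) F) = LinearMap.id := by
  refine LinearMap.ext fun v => ?_
  simp [glMap_apply]

theorem glMap_mul (g h : GL (Fin 3) F) : glMap (g * h) = (glMap g).comp (glMap h) := by
  refine LinearMap.ext fun v => ?_
  simp [glMap_apply, Matrix.mulVec_mulVec]

theorem isLattice_map (g : GL (Fin 3) F) (Λ : Lattice F) :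
    Submodule.IsLattice F (Λ.1.map (glMap g)) where
  fg := Λ.2.fg.map _
  span_eq_top := by
    have h : ((Λ.1.map (glMap g) : Submodule 𝒪[F] (Fin 3 → F)) : Set (Fin 3 → F))
        = (Matrix.mulVecLin (g : Matrix (Fin 3) (Fin 3) F)) '' (Λ.1 : Set (Fin 3 → F)) := rfl
    rw [h, Submodule.span_image, Λ.2.span_eq_top, Submodule.map_top, LinearMap.range_eq_top]
    intro v
    refine ⟨((g⁻¹ : GL (Fin 3) F) : Matrix (Fin 3) (Fin 3) F).mulVec v, ?_⟩
    rw [Matrix.mulVecLin_apply, Matrix.mulVec_mulVec, ← Units.val_mul, mul_inv_cancel,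
      Units.val_one, Matrix.one_mulVec]

/-- `GL₃(F)` acts on lattices by `g • Λ = g Λ`. -/
instance instGLLattice : MulAction (GL (Fin 3) F) (Lattice F) where
  smul g Λ := ⟨Λ.1.map (glMap g), isLattice_map g Λ⟩
  one_smul Λ := Subtype.ext (by
    change Λ.1.map (glMap 1) = Λ.1
    rw [glMap_one, Submodule.map_id])
  mul_smul g h Λ := Subtype.ext (by
    change Λ.1.map (glMap (g * h)) = (Λ.1.map (glMap h)).map (glMap g)
    rw [glMap_mul, Submodule.map_comp])

/-- The multiple `α Λ` of a lattice by a nonzero scalar. -/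
def Lattice.scale (α : Fˣ) (Λ : Lattice F) : Lattice F :=
  Matrix.GeneralLinearGroup.scalar (Fin 3) α • Λ

theorem scale_mul (α β : Fˣ) (Λ : Lattice F) :
    Lattice.scale (α * β) Λ = Lattice.scale α (Lattice.scale β Λ) := by
  simp only [Lattice.scale, map_mul, mul_smul]

theorem scale_one (Λ : Lattice F) : Lattice.scale 1 Λ = Λ := by
  simp only [Lattice.scale, map_one, one_smul]

theorem smul_scale (g : GL (Fin 3) F) (α : Fˣ) (Λ : Lattice F) :
    g • Lattice.scale α Λ = Lattice.scale α (g • Λ) := by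
  have h : g * Matrix.GeneralLinearGroup.scalar (Fin 3) α =
      Matrix.GeneralLinearGroup.scalar (Fin 3) α * g := by
    ext i j
    simp [Matrix.GeneralLinearGroup.scalar, mul_comm]
  simp only [Lattice.scale, ← mul_smul, h]

variable (F) in
/-- Homothety of lattices: `Λ' = α Λ` for some `α ∈ Fˣ`. -/
def homothety : Setoid (Lattice F) where
  r Λ Λ' := ∃ α : Fˣ, Λ' = Λ.scale α
  iseqv :=
    { refl := fun Λ => ⟨1, (scale_one Λ).symm⟩
      symm := by
        rintro Λ _ ⟨α, rfl⟩
        exact ⟨α⁻¹, by rw [← scale_mul, inv_mul_cancel, scale_one]⟩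
      trans := by
        rintro Λ _ _ ⟨α, rfl⟩ ⟨β, rfl⟩
        exact ⟨β * α, by rw [scale_mul]⟩ }

variable (F) in
/-- The vertices of the building: homothety classes of lattices. -/
def Vertex : Type _ := Quotient (homothety F)

/-- The homothety class `[Λ]`. -/
def Lattice.toVertex (Λ : Lattice F) : Vertex F := Quotient.mk (homothety F) Λ

instance instGLVertex : MulAction (GL (Fin 3) F) (Vertex F) where
  smul g := Quotient.map (fun Λ => g • Λ) (by
    rintro Λ _ ⟨α, rfl⟩
    exact ⟨α, smul_scale g α Λ⟩)
  one_smul x := by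
    induction x using Quotient.inductionOn with
    | h Λ => exact congrArg Lattice.toVertex (one_smul _ Λ)
  mul_smul g h x := by
    induction x using Quotient.inductionOn with
    | h Λ => exact congrArg Lattice.toVertex (mul_smul g h Λ)

theorem scalar_smul_vertex (α : Fˣ) (x : Vertex F) :
    Matrix.GeneralLinearGroup.scalar (Fin 3) α • x = x := by
  induction x using Quotient.inductionOn with
  | h Λ => exact (Quotient.sound (s := homothety F) ⟨α, rfl⟩).symm

/-- The action of `PGL₃(F)` on the vertices, `[g] • [Λ] = [g Λ]`. -/
instance instPGLVertex : MulAction PGL(3, F) (Vertex F) :=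
  Matrix.ProjGenLinGroup.mulActionOfGL scalar_smul_vertex

/-- The quotient topology on `PGL₃(F) = GL₃(F) / Fˣ`. -/
instance instTopPGL [TopologicalSpace F] : TopologicalSpace PGL(3, F) :=
  TopologicalSpace.coinduced (Matrix.ProjGenLinGroup.mk : GL (Fin 3) F →* PGL(3, F)) inferInstance

/-- The lattice `𝒪 b₀ ⊕ 𝒪 b₁ ⊕ 𝒪 b₂` of a basis `b` of `F³`. -/
def latticeOfBasis (b : Module.Basis (Fin 3) F (Fin 3 → F)) : Lattice F :=
  ⟨Submodule.span 𝒪[F] (Set.range b),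
    { fg := Submodule.fg_span (Set.finite_range b)
      span_eq_top := by rw [Submodule.span_span_of_tower, b.span_eq] }⟩

end Lattices

section Building

variable {F : Type*} [Field F] [ValuativeRel F]

/-- `ϖ` generates the maximal ideal of the valuation ring. -/
def IsUniformizer (ϖ : Fˣ) : Prop := ∃ π : 𝒪[F], Irreducible π ∧ (π : F) = ϖ

/-- The vertex `[ϖ ^ a₀ 𝒪 b₀ ⊕ ϖ ^ a₁ 𝒪 b₁ ⊕ ϖ ^ a₂ 𝒪 b₂]`. For a fixed basis `b`, these are the
vertices of the apartment of `b`; the apartment is the affine plane `ℝ³ / ℝ (1, 1, 1)`, and this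
vertex is the image of `a`. -/
def apartmentVertex (ϖ : Fˣ) (b : Module.Basis (Fin 3) F (Fin 3 → F)) (a : Fin 3 → ℤ) : Vertex F :=
  (latticeOfBasis (b.unitsSMul fun i => ϖ ^ a i)).toVertex

/-- Two vertices are joined by an edge if they are distinct and have representatives with
`ϖ Λ₁ ⊆ Λ₂ ⊆ Λ₁`. -/
def Adj (ϖ : Fˣ) (x y : Vertex F) : Prop :=
  x ≠ y ∧ ∃ Λ₁ Λ₂ : Lattice F, Λ₁.toVertex = x ∧ Λ₂.toVertex = y ∧
    (Λ₁.scale ϖ).1 ≤ Λ₂.1 ∧ Λ₂.1 ≤ Λ₁.1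

/-- The vertices `[𝒪 e₁ ⊕ 𝒪 e₂ ⊕ 𝒪 e₃]`, `[𝒪 e₁ ⊕ 𝒪 e₂ ⊕ ϖ 𝒪 e₃]`, `[𝒪 e₁ ⊕ ϖ 𝒪 e₂ ⊕ ϖ 𝒪 e₃]`. -/
def standardVertex (ϖ : Fˣ) (j : Fin 3) : Vertex F :=
  apartmentVertex ϖ (Pi.basisFun F (Fin 3))
    ((![![0, 0, 0], ![0, 0, 1], ![0, 1, 1]] : Fin 3 → Fin 3 → ℤ) j)

/-- `x` is of type `j` if it lies in the orbit of the `j`-th standard vertex under the image of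
`SL₃(F)` in `PGL₃(F)`. -/
def HasType (ϖ : Fˣ) (x : Vertex F) (j : Fin 3) : Prop :=
  ∃ g : SL(3, F), x = Matrix.SpecialLinearGroup.toPGL g • standardVertex ϖ j

/-- `(x, y)` is a positively oriented edge: the type of `y` is that of `x` plus one, modulo `3`. -/
def PosAdj (ϖ : Fˣ) (x y : Vertex F) : Prop :=
  Adj ϖ x y ∧ ∃ j : Fin 3, HasType ϖ x j ∧ HasType ϖ y (j + 1)

/-- Rank-one geodesics, as bi-infinite sequences of vertices: straight oriented lines in an
apartment that run along edges. -/
def IsRankOneGeodesic (ϖ : Fˣ) (c : ℤ → Vertex F) : Prop :=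
  (∃ (b : Module.Basis (Fin 3) F (Fin 3 → F)) (a v : Fin 3 → ℤ),
    ∀ k : ℤ, c k = apartmentVertex ϖ b (a + k • v)) ∧
  ∀ k : ℤ, Adj ϖ (c k) (c (k + 1))

end Building

section Quotient

variable {F : Type*} [Field F] [ValuativeRel F] (Γ : Subgroup PGL(3, F))

/-- `Γ`-orbits of vertices. -/
abbrev QVertex : Type _ := MulAction.orbitRel.Quotient Γ (Vertex F)

/-- `Γ`-orbits of ordered pairs of vertices. The oriented edges of `Γ \ X` are such orbits. -/
abbrev QPair : Type _ := MulAction.orbitRel.Quotient Γ (Vertex F × Vertex F)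

/-- The orbit of `(x, y)`. -/
def qpair (x y : Vertex F) : QPair Γ := Quotient.mk (MulAction.orbitRel Γ _) (x, y)

/-- Reversal of orientation: the orbit of `(x, y)` goes to that of `(y, x)`. -/
def QPair.rev : QPair Γ → QPair Γ :=
  Quotient.map Prod.swap (by
    rintro _ p ⟨γ, rfl⟩
    exact ⟨γ, rfl⟩)

theorem QPair.rev_rev (p : QPair Γ) : QPair.rev Γ (QPair.rev Γ p) = p := by
  induction p using Quotient.inductionOn with
  | h p => rfl

/-- The set `E(Γ \ X)` of positively oriented edges of `Γ \ X`. -/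
def PosEdge (ϖ : Fˣ) : Type _ := {e : QPair Γ // ∃ x y : Vertex F, PosAdj ϖ x y ∧ e = qpair Γ x y}

/-- `e → e'`: the end point of `e` is the starting point of `e'`, and together they lie on a
rank-one geodesic. -/
def Continues (ϖ : Fˣ) (e e' : PosEdge Γ ϖ) : Prop :=
  ∃ c : ℤ → Vertex F, IsRankOneGeodesic ϖ c ∧ e.1 = qpair Γ (c 0) (c 1) ∧ e'.1 = qpair Γ (c 1) (c 2)

/-- The operator `T e = ∑_{e → e'} e'` on the vector space with basis `E(Γ \ X)`. -/
def edgeOperator (ϖ : Fˣ) : (PosEdge Γ ϖ →₀ ℂ) →ₗ[ℂ] (PosEdge Γ ϖ →₀ ℂ) :=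
  Finsupp.linearCombination ℂ fun e =>
    ∑ᶠ e' ∈ {e' : PosEdge Γ ϖ | Continues Γ ϖ e e'}, Finsupp.single e' (1 : ℂ)

/-- Closed rank-one geodesics in `Γ \ X`, with a starting point: the image of a rank-one geodesic
of `X`, recorded through its sequence of oriented edges, together with a positive period `length`
of this sequence. -/
structure ClosedGeodesic (ϖ : Fˣ) where
  path : ℤ → QPair Γ
  length : ℕ
  isGeodesic : ∃ c : ℤ → Vertex F, IsRankOneGeodesic ϖ c ∧ ∀ k, path k = qpair Γ (c k) (c (k + 1))
  length_pos : 0 < length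
  periodic : Function.Periodic path (length : ℤ)

variable {Γ} in
/-- A closed geodesic is primitive if it goes round exactly once, that is, if its length is the
smallest positive period. -/
def ClosedGeodesic.IsPrimitive {ϖ : Fˣ} (c : ClosedGeodesic Γ ϖ) : Prop :=
  ∀ n : ℕ, 0 < n → Function.Periodic c.path (n : ℤ) → c.length ≤ n

/-- Primitive closed rank-one geodesics are identified if they have the same length and differ by
a change of the starting point or by reversal of orientation. -/
def geodesicSetoid (ϖ : Fˣ) : Setoid {c : ClosedGeodesic Γ ϖ // c.IsPrimitive} where
  r c d := c.1.length = d.1.length ∧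
    ((∃ j : ℤ, ∀ k, d.1.path k = c.1.path (k + j)) ∨
      (∃ j : ℤ, ∀ k, d.1.path k = QPair.rev Γ (c.1.path (j - k))))
  iseqv :=
    { refl := fun c => ⟨rfl, Or.inl ⟨0, fun k => by rw [add_zero]⟩⟩
      symm := by
        rintro c d ⟨hl, ⟨j, h⟩ | ⟨j, h⟩⟩
        · exact ⟨hl.symm, Or.inl ⟨-j, fun k => by rw [h, neg_add_cancel_right]⟩⟩
        · exact ⟨hl.symm, Or.inr ⟨j, fun k => by rw [h, QPair.rev_rev, sub_sub_cancel]⟩⟩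
      trans := by
        rintro c d e ⟨hl, ⟨j, h⟩ | ⟨j, h⟩⟩ ⟨hl', ⟨i, h'⟩ | ⟨i, h'⟩⟩
        · exact ⟨hl.trans hl', Or.inl ⟨i + j, fun k => by rw [h', h, add_assoc]⟩⟩
        · exact ⟨hl.trans hl', Or.inr ⟨i + j, fun k => by rw [h', h, sub_add_eq_add_sub]⟩⟩
        · exact ⟨hl.trans hl', Or.inr ⟨j - i, fun k => by rw [h', h, sub_sub, add_comm k i]⟩⟩
        · exact ⟨hl.trans hl', Or.inl ⟨j - i, fun k => by
            rw [h', h, QPair.rev_rev]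
            congr 1
            ring⟩⟩ }

/-- The set of primitive closed rank-one geodesics in `Γ \ X` modulo reversal of orientation. -/
def PrimitiveGeodesic (ϖ : Fˣ) : Type _ := Quotient (geodesicSetoid Γ ϖ)

variable {Γ} in
/-- The length `l(c)`; every edge has length one. -/
def PrimitiveGeodesic.length {ϖ : Fˣ} : PrimitiveGeodesic Γ ϖ → ℕ :=
  Quotient.lift (fun c => c.1.length) fun _ _ h => h.1

/-- The Euler factor `1 - u ^ l(c)`, as a formal power series in `u`. -/
def eulerFactor (ϖ : Fˣ) (c : PrimitiveGeodesic Γ ϖ) : ℂ⟦X⟧ :=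
  1 - PowerSeries.X ^ c.length

/-- `Z₁(u) = ∏ (1 - u ^ l(c))` as a formal power series, with coefficientwise convergence. -/
def Z₁ (ϖ : Fˣ) : ℂ⟦X⟧ := ∏' c : PrimitiveGeodesic Γ ϖ, eulerFactor Γ ϖ c

end Quotient

end PGL3Building

end

open PGL3Building

noncomputable section

namespace PGL3Building

/-! ### Determinants, logarithmic derivatives and Euler products -/

section DetZeta

/-! The product `Z₁` is the Euler product over the cycles of a finite directed graph: its nodes are
the positively oriented edges of `Γ \ X`, its arrows are given by `Continues`, and its 0-1 matrix
`A` is the transpose of the matrix of `T`.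

For any finite graph, `∏ (1 - u ^ ℓ)` over primitive periodic orbits equals `det (1 - u A)`. Both
sides have constant term 1 and satisfy `u f' = - f ∑ tr (A ^ n) u ^ n`: for the determinant this is
Jacobi's formula, and for the product it holds because `tr (A ^ n)` counts the paths of period `n`,
and an orbit of length `ℓ` contributes `ℓ` of them whenever `ℓ ∣ n` (`hasProd_one_sub_X_pow`,
`hasProd_primitive_orbits`).

Two properties of the building identify these orbits with the closed geodesics. Up to reversal,
every rank-one geodesic is a standard line `k ↦ g diag (1, 1, ϖ) ^ k [𝒪³]`
(`isRankOneGeodesic_iff`). Such a line has positive edges, and the reverse of a positive edge is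
never positive, so an unoriented closed geodesic has exactly one positive direction. Moreover,
straightness is local: two lines sharing an edge can be spliced (`exists_line_extend_right`,
`exists_line_extend_left`), which lifts finite pieces of a path of arrows to lines, and compactness
of `GL₃(𝒪)` lifts the whole path (`exists_line_of_continues`).

Finiteness of the graph and the degree come from the local structure. Cocompactness leaves finitely
many vertices (`finite_qVertex`), and `Γ` acts freely on vertices, as vertex stabilizers in `Γ` are
torsion (`eq_one_of_smul_eq`). Hence the edges leaving a vertex of `Γ \ X`, and likewise those
entering it, are parametrized by the projective plane over the residue field, with an arrow exactly
when point and line are not incident (`exists_line_iff`). This gives `q² + q + 1` edges per vertex.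
The non-incidence matrix of a projective plane is invertible (`eq_zero_of_sum_not_orthogonal`), so
`A` is invertible and `det (1 - u A)` has full degree. -/

theorem derivation_prod {R A ι : Type*} [CommRing R] [CommRing A] [Algebra R A] [DecidableEq ι]
    (d : Derivation R A A) (s : Finset ι) (f : ι → A) :
    d (∏ i ∈ s, f i) = ∑ i ∈ s, (∏ j ∈ s.erase i, f j) * d (f i) := by
  induction s using Finset.induction_on with
  | empty => simp
  | insert a s ha ih =>
    rw [Finset.prod_insert ha, Derivation.leibniz, ih, Finset.sum_insert ha,
      Finset.erase_insert ha, smul_eq_mul, smul_eq_mul, add_comm, Finset.mul_sum]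
    congr 1
    refine Finset.sum_congr rfl fun i hi => ?_
    have hai : a ≠ i := fun h => ha (h ▸ hi)
    rw [Finset.erase_insert_of_ne hai, Finset.prod_insert (by simp [ha]), mul_assoc]

/-- Jacobi's formula for the derivative of a determinant. -/
theorem derivation_det {R A n : Type*} [CommRing R] [CommRing A] [Algebra R A] [DecidableEq n]
    [Fintype n] (d : Derivation R A A) (B : Matrix n n A) :
    d B.det = (B.adjugate * B.map d).trace := by
  -- By Cramer's rule, each diagonal entry is the determinant with one column differentiated; what
  -- remains is the Leibniz rule in the expansion over permutations.
  have h : ∀ i, (B.adjugate * B.map d) i i = (B.updateCol i fun k => d (B k i)).det := by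
    intro i
    rw [← Matrix.cramer_apply, Matrix.cramer_eq_adjugate_mulVec]
    rfl
  simp only [Matrix.trace, Matrix.diag_apply, h]
  rw [Matrix.det_apply, map_sum]
  simp only [Matrix.det_apply]
  rw [Finset.sum_comm]
  refine Finset.sum_congr rfl fun σ _ => ?_
  rw [← Finset.smul_sum, Units.smul_def, Units.smul_def, map_zsmul, derivation_prod]
  congr 1
  refine Finset.sum_congr rfl fun i _ => ?_
  rw [← Finset.mul_prod_erase _ _ (Finset.mem_univ i), Matrix.updateCol_self, mul_comm]
  congr 1
  refine Finset.prod_congr rfl fun j hj => ?_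
  rw [Matrix.updateCol_ne (Finset.ne_of_mem_erase hj)]

variable {E : Type*} [Fintype E] [DecidableEq E]

/-- `det (1 - X A)` satisfies `X D' = - D ∑ tr (A ^ m) X ^ m`. -/
theorem X_mul_derivative_charpolyRev (A : Matrix E E ℂ) :
    PowerSeries.X * PowerSeries.derivative ℂ (A.charpolyRev : ℂ⟦X⟧) =
      -((A.charpolyRev : ℂ⟦X⟧) *
        PowerSeries.mk fun m => if m = 0 then 0 else (A ^ m).trace) := by
  set B : Matrix E E ℂ⟦X⟧ := 1 - (PowerSeries.X : ℂ⟦X⟧) • A.map (PowerSeries.C (R := ℂ)) with hB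
  set S : Matrix E E ℂ⟦X⟧ := Matrix.of fun i j => PowerSeries.mk fun k => (A ^ k) i j with hS
  have hdet : (A.charpolyRev : ℂ⟦X⟧) = B.det := by
    rw [Matrix.charpolyRev, ← Polynomial.coeToPowerSeries.ringHom_apply, RingHom.map_det]
    congr 1
    ext1 i j
    simp only [hB, RingHom.mapMatrix_apply, Matrix.map_apply, Matrix.sub_apply, Matrix.smul_apply,
      Matrix.one_apply, smul_eq_mul, map_sub, map_mul, Polynomial.coeToPowerSeries.ringHom_apply,
      Polynomial.coe_X, Polynomial.coe_C]
    split_ifs <;> simp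
  -- `S` is the geometric series of `X A`.
  have hBS : B * S = 1 := by
    rw [hB, Matrix.sub_mul, Matrix.one_mul, Matrix.smul_mul]
    ext i j m
    rw [Matrix.sub_apply, Matrix.smul_apply, smul_eq_mul, map_sub, Matrix.mul_apply]
    cases m with
    | zero => simp [hS, Matrix.one_apply]
    | succ m =>
      rw [PowerSeries.coeff_succ_X_mul, map_sum]
      simp only [hS, Matrix.of_apply, PowerSeries.coeff_mk, Matrix.map_apply,
        PowerSeries.coeff_C_mul]
      rw [pow_succ', Matrix.mul_apply, sub_self, Matrix.one_apply]
      split_ifs <;> simp [PowerSeries.coeff_one]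
  have hadj : B.adjugate = B.det • S := by
    have h := congrArg (· * S) (Matrix.adjugate_mul B)
    simpa [Matrix.mul_assoc, hBS] using h
  have hd : B.map (PowerSeries.derivative ℂ) = -A.map (PowerSeries.C (R := ℂ)) := by
    ext1 i j
    simp only [hB, Matrix.map_apply, Matrix.sub_apply, Matrix.smul_apply, smul_eq_mul, map_sub,
      Matrix.neg_apply, Derivation.leibniz, PowerSeries.derivative_C, PowerSeries.derivative_X,
      Matrix.one_apply]
    split_ifs <;> simp
  rw [hdet, derivation_det, hadj, hd, Matrix.smul_mul, Matrix.trace_smul, smul_eq_mul,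
    mul_left_comm, ← mul_neg]
  congr 1
  rw [Matrix.mul_neg, Matrix.trace_neg, mul_neg, neg_inj]
  ext m
  cases m with
  | zero => simp
  | succ m =>
    rw [PowerSeries.coeff_succ_X_mul, PowerSeries.coeff_mk, if_neg (Nat.succ_ne_zero m), pow_succ]
    simp only [Matrix.trace, Matrix.diag_apply, Matrix.mul_apply, map_sum, hS, Matrix.of_apply,
      Matrix.map_apply, PowerSeries.coeff_mul_C, PowerSeries.coeff_mk]

/-- The geometric series of `X ^ l` without its constant term, times `l`: up to sign this is the
logarithmic derivative `X f' / f` of one Euler factor. -/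
theorem one_sub_X_pow_mul_mk {l : ℕ} (hl : 0 < l) :
    (1 - PowerSeries.X ^ l : ℂ⟦X⟧) * (PowerSeries.mk fun m => if 0 < m ∧ l ∣ m then (l : ℂ) else 0)
      = PowerSeries.C (l : ℂ) * PowerSeries.X ^ l := by
  ext m
  rw [sub_mul, one_mul, map_sub, PowerSeries.coeff_X_pow_mul', PowerSeries.coeff_C_mul,
    PowerSeries.coeff_X_pow, PowerSeries.coeff_mk, PowerSeries.coeff_mk]
  rcases lt_trichotomy m l with h | rfl | h
  · have h2 : ¬ (0 < m ∧ l ∣ m) := fun h3 => absurd (Nat.le_of_dvd h3.1 h3.2) (by omega)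
    simp [h2, h.ne, not_le.2 h]
  · simp [hl]
  · have h2 : l ∣ m - l ↔ l ∣ m := by
      rw [Nat.dvd_sub_iff_left h.le dvd_rfl]
    simp [h2, h.le, h.ne', h, (hl.trans h)]

theorem X_mul_derivative_one_sub_X_pow {l : ℕ} (hl : 0 < l) :
    PowerSeries.X * PowerSeries.derivative ℂ (1 - PowerSeries.X ^ l : ℂ⟦X⟧) =
      -((1 - PowerSeries.X ^ l) * PowerSeries.mk fun m => if 0 < m ∧ l ∣ m then (l : ℂ) else 0) := by
  rw [one_sub_X_pow_mul_mk hl, map_sub, Derivation.map_one_eq_zero, PowerSeries.derivative_pow,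
    PowerSeries.derivative_X, zero_sub, mul_neg, neg_inj]
  obtain ⟨k, rfl⟩ : ∃ k, l = k + 1 := ⟨l - 1, by omega⟩
  simp only [Nat.add_sub_cancel, map_natCast, mul_one]
  ring

theorem X_mul_derivative_prod {ι : Type*} (ℓ : ι → ℕ) (hℓ : ∀ c, 0 < ℓ c) (s : Finset ι) :
    PowerSeries.X * PowerSeries.derivative ℂ (∏ c ∈ s, (1 - PowerSeries.X ^ ℓ c) : ℂ⟦X⟧) =
      -((∏ c ∈ s, (1 - PowerSeries.X ^ ℓ c)) * PowerSeries.mk fun m =>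
        ∑ c ∈ s, if 0 < m ∧ ℓ c ∣ m then (ℓ c : ℂ) else 0) := by
  classical
  rw [derivation_prod, Finset.mul_sum]
  have h : (PowerSeries.mk fun m => ∑ c ∈ s, if 0 < m ∧ ℓ c ∣ m then (ℓ c : ℂ) else 0) =
      ∑ c ∈ s, PowerSeries.mk fun m => if 0 < m ∧ ℓ c ∣ m then (ℓ c : ℂ) else 0 := by
    ext m
    simp
  rw [h, Finset.mul_sum, ← Finset.sum_neg_distrib]
  refine Finset.sum_congr rfl fun c hc => ?_
  rw [mul_left_comm, X_mul_derivative_one_sub_X_pow (hℓ c), mul_neg, ← mul_assoc,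
    Finset.prod_erase_mul s _ hc]

/-- The equation `X f' = - f g` determines the coefficients of `f` recursively. -/
theorem coeff_eq_of_X_mul_derivative {f₁ f₂ g₁ g₂ : ℂ⟦X⟧}
    (h₁ : PowerSeries.X * PowerSeries.derivative ℂ f₁ = -(f₁ * g₁))
    (h₂ : PowerSeries.X * PowerSeries.derivative ℂ f₂ = -(f₂ * g₂))
    (h0 : PowerSeries.coeff 0 f₁ = PowerSeries.coeff 0 f₂) (N : ℕ)
    (hg : ∀ m ≤ N, PowerSeries.coeff m g₁ = PowerSeries.coeff m g₂)
    (hg0 : PowerSeries.coeff 0 g₁ = 0) :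
    ∀ m ≤ N, PowerSeries.coeff m f₁ = PowerSeries.coeff m f₂ := by
  intro m
  induction m using Nat.strong_induction_on with
  | h m ih =>
    intro hm
    cases m with
    | zero => exact h0
    | succ m =>
      have e₁ := congrArg (PowerSeries.coeff (m + 1)) h₁
      have e₂ := congrArg (PowerSeries.coeff (m + 1)) h₂
      rw [PowerSeries.coeff_succ_X_mul, PowerSeries.coeff_derivative, map_neg,
        PowerSeries.coeff_mul] at e₁ e₂
      have e : ∑ p ∈ Finset.HasAntidiagonal.antidiagonal (m + 1), PowerSeries.coeff p.1 f₁ * PowerSeries.coeff p.2 g₁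
          = ∑ p ∈ Finset.HasAntidiagonal.antidiagonal (m + 1),
            PowerSeries.coeff p.1 f₂ * PowerSeries.coeff p.2 g₂ := by
        refine Finset.sum_congr rfl fun p hp => ?_
        have hp := Finset.HasAntidiagonal.mem_antidiagonal.1 hp
        rw [← hg p.2 (by omega)]
        -- The only term containing the still unknown top coefficient has `p.2 = 0`, and there the
        -- constant term of `g₁` vanishes.
        rcases Nat.eq_zero_or_pos p.2 with h | h
        · rw [h, hg0, mul_zero, mul_zero]
        · rw [ih p.1 (by omega) (by omega)]
      rw [e, ← e₂] at e₁
      exact mul_right_cancel₀ (by exact_mod_cast Nat.succ_ne_zero m) e₁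

/-- Once a finite set `s` contains every index with `ℓ c ≤ N`, the partial product and the
determinant satisfy the same differential equation up to order `N`. Each coefficient of the partial
products is therefore eventually constant. -/
theorem hasProd_one_sub_X_pow (A : Matrix E E ℂ) {ι : Type*} (ℓ : ι → ℕ) (hℓ : ∀ c, 0 < ℓ c)
    (hfin : ∀ n, {c | ℓ c ≤ n}.Finite)
    (htr : ∀ n, 0 < n → ∀ s : Finset ι, (∀ c, ℓ c ≤ n → c ∈ s) →
      (A ^ n).trace = ∑ c ∈ s, if ℓ c ∣ n then (ℓ c : ℂ) else 0) :
    HasProd (fun c => (1 - PowerSeries.X ^ ℓ c : ℂ⟦X⟧)) (A.charpolyRev : ℂ⟦X⟧) := by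
  rw [HasProd, SummationFilter.unconditional_filter, PowerSeries.WithPiTopology.tendsto_iff_coeff_tendsto]
  intro N
  refine tendsto_const_nhds.congr' ?_
  filter_upwards [Filter.eventually_ge_atTop (hfin N).toFinset] with s hs
  have hs' : ∀ c, ℓ c ≤ N → c ∈ s := fun c hc => hs (by simpa using hc)
  refine coeff_eq_of_X_mul_derivative (X_mul_derivative_charpolyRev A)
    (X_mul_derivative_prod ℓ hℓ s) ?_ N ?_ (by simp) N le_rfl
  · rw [Polynomial.coeff_coe, Polynomial.coeff_zero_eq_eval_zero, Matrix.eval_charpolyRev,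
      PowerSeries.coeff_zero_eq_constantCoeff_apply, map_prod]
    refine (Finset.prod_eq_one fun c _ => ?_).symm
    simp [(hℓ c).ne']
  · intro m hm
    rw [PowerSeries.coeff_mk, PowerSeries.coeff_mk]
    rcases Nat.eq_zero_or_pos m with rfl | h
    · simp
    · rw [if_neg h.ne', htr m h s fun c hc => hs' c (hc.trans hm)]
      simp [h]

/-- Reversing the characteristic polynomial lowers the degree only if its constant term, `± det A`,
vanishes. -/
theorem natDegree_charpolyRev (A : Matrix E E ℂ) (hA : A.det ≠ 0) :
    A.charpolyRev.natDegree = Fintype.card E := by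
  rw [← Matrix.reverse_charpoly, Polynomial.reverse_natDegree, Matrix.charpoly_natDegree_eq_dim,
    Polynomial.natTrailingDegree_eq_zero_of_constantCoeff_ne_zero, Nat.sub_zero]
  intro h
  rw [Matrix.det_eq_sign_charpoly_coeff] at hA
  rw [Polynomial.constantCoeff_apply] at h
  simp [h] at hA

end DetZeta

/-! ### Periodic paths and primitive orbits of a finite relation -/

section Paths

variable {E : Type*}

/-- Bi-infinite paths of period `n` for the relation `r`. -/
def PeriodicPath (r : E → E → Prop) (n : ℕ) : Type _ :=
  {p : ℤ → E // (∀ k, r (p k) (p (k + 1))) ∧ Function.Periodic p (n : ℤ)}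

theorem periodic_natAbs {p : ℤ → E} {m : ℤ} (h : Function.Periodic p m) :
    Function.Periodic p (m.natAbs : ℤ) := by
  rcases Int.natAbs_eq m with h' | h'
  · rwa [← h']
  · rw [eq_comm, neg_eq_iff_eq_neg] at h'
    rw [h']
    exact h.neg

theorem periodic_emod {p : ℤ → E} {n m : ℕ} (hn : Function.Periodic p (n : ℤ))
    (hm : Function.Periodic p (m : ℤ)) : Function.Periodic p ((m % n : ℕ) : ℤ) := by
  have h : ((m % n : ℕ) : ℤ) = (m : ℤ) - (m / n : ℕ) * n := by
    have := Nat.div_add_mod m n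
    rw [mul_comm] at this
    zify at this ⊢
    linarith
  rw [h]
  exact hm.sub_period (hn.nat_mul _)

theorem dvd_of_periodic {p : ℤ → E} {n m : ℕ} (hn0 : 0 < n) (hn : Function.Periodic p (n : ℤ))
    (hmin : ∀ k : ℕ, 0 < k → Function.Periodic p (k : ℤ) → n ≤ k)
    (hm : Function.Periodic p (m : ℤ)) : n ∣ m := by
  rw [Nat.dvd_iff_mod_eq_zero]
  by_contra h
  exact absurd (hmin _ (Nat.pos_of_ne_zero h) (periodic_emod hn hm)) (not_le.2 (Nat.mod_lt _ hn0))

theorem periodic_apply_emod {p : ℤ → E} {n : ℕ} (hn : Function.Periodic p (n : ℤ)) (k : ℤ) :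
    p (k % n) = p k := by
  rw [Int.emod_def, mul_comm]
  exact hn.sub_zsmul_eq (k / n) (x := k)

/-- Closed walks with `n` steps and a starting point. -/
def ClosedWalk (r : E → E → Prop) (n : ℕ) : Type _ :=
  {f : Fin (n + 1) → E // f 0 = f (Fin.last n) ∧ ∀ k : Fin n, r (f k.castSucc) (f k.succ)}

theorem card_periodicPath (r : E → E → Prop) {n : ℕ} (hn : 0 < n) :
    Nat.card (PeriodicPath r n) = Nat.card (ClosedWalk r n) := by
  have hn' : (0 : ℤ) < n := by exact_mod_cast hn
  refine Nat.card_eq_of_bijective (fun p => ⟨fun k => p.1 (k : ℕ), ?_, ?_⟩) ⟨?_, ?_⟩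
  · simpa using (p.2.2.eq).symm
  · intro k
    simpa using p.2.1 k
  · rintro ⟨p, hp, hp'⟩ ⟨q, hq, hq'⟩ h
    refine Subtype.ext (funext fun k => ?_)
    change p k = q k
    rw [← periodic_apply_emod hp', ← periodic_apply_emod hq']
    have h1 := Int.emod_nonneg k hn'.ne'
    have h2 := Int.emod_lt_of_pos k hn'
    have h3 := congrFun (congrArg Subtype.val h) ⟨(k % n).toNat, by omega⟩
    simpa [Int.toNat_of_nonneg h1] using h3
  · rintro ⟨f, hf, hf'⟩
    have hb : ∀ k : ℤ, (k % n).toNat < n + 1 := fun k => by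
      have h2 := Int.emod_lt_of_pos k hn'
      omega
    refine ⟨⟨fun k => f ⟨(k % n).toNat, hb k⟩, ?_, ?_⟩, ?_⟩
    · intro k
      have h1 := Int.emod_nonneg k hn'.ne'
      have h2 := Int.emod_lt_of_pos k hn'
      have h := hf' ⟨(k % n).toNat, by omega⟩
      convert! h using 1
      -- At the seam the residue of `k + 1` jumps back to `0` while the walk goes on to its last
      -- vertex; closedness identifies the two.
      by_cases h3 : k % n + 1 = n
      · have h4 : (k + 1) % n = 0 := by
          rw [← Int.emod_add_emod, h3, Int.emod_self]
        simp only [h4]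
        refine hf.trans (congrArg f (Fin.ext ?_))
        simp
        omega
      · have h4 : (k + 1) % n = k % n + 1 := by
          rw [← Int.emod_add_emod]
          exact Int.emod_eq_of_lt (by omega) (by omega)
        refine congrArg f (Fin.ext ?_)
        simp [h4]
        omega
    · intro k
      simp
    · refine Subtype.ext (funext fun k => ?_)
      change f _ = f k
      rcases Nat.lt_succ_iff_lt_or_eq.1 k.2 with h | h
      · refine congrArg f (Fin.ext ?_)
        change (((k : ℕ) : ℤ) % n).toNat = k
        rw [Int.emod_eq_of_lt (by omega) (by omega), Int.toNat_natCast]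
      · have hk : k = Fin.last n := Fin.ext h
        rw [hk, ← hf]
        exact congrArg f (Fin.ext (by simp))

theorem finite_periodicPath [Finite E] (r : E → E → Prop) {n : ℕ} (hn : 0 < n) :
    Finite (PeriodicPath r n) := by
  have hn' : (0 : ℤ) < n := by exact_mod_cast hn
  refine Finite.of_injective (β := Fin n → E) (fun p k => p.1 (k : ℕ)) ?_
  rintro ⟨p, hp, hp'⟩ ⟨q, hq, hq'⟩ h
  refine Subtype.ext (funext fun k => ?_)
  change p k = q k
  rw [← periodic_apply_emod hp', ← periodic_apply_emod hq']
  have h1 := Int.emod_nonneg k hn'.ne'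
  have h2 := Int.emod_lt_of_pos k hn'
  have h3 := congrFun h ⟨(k % n).toNat, by omega⟩
  simpa [Int.toNat_of_nonneg h1] using h3

variable [Fintype E] [DecidableEq E]

open Classical in
/-- The 0-1 matrix of a relation. -/
def relMatrix (r : E → E → Prop) : Matrix E E ℂ := Matrix.of fun e e' => if r e e' then 1 else 0

open Classical in
theorem relMatrix_pow_apply (r : E → E → Prop) (n : ℕ) (i j : E) :
    (relMatrix r ^ n) i j = ∑ f : Fin (n + 1) → E,
      if f 0 = i ∧ f (Fin.last n) = j ∧ ∀ k : Fin n, r (f k.castSucc) (f k.succ)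
        then (1 : ℂ) else 0 := by
  induction n generalizing i with
  | zero =>
    rw [pow_zero, Matrix.one_apply, Fintype.sum_equiv (Equiv.funUnique (Fin 1) E) _
      (fun e => if e = i ∧ e = j then (1 : ℂ) else 0) (fun f => by simp)]
    simp_rw [ite_and]
    simp
  | succ n ih =>
    -- A walk with `n + 1` steps is its first vertex followed by a walk with `n` steps.
    rw [pow_succ', Matrix.mul_apply, ← Fintype.sum_equiv (Fin.consEquiv fun _ : Fin (n + 2) => E)
      (fun q => if q.1 = i ∧ q.2 (Fin.last n) = j ∧ r q.1 (q.2 0) ∧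
        ∀ k : Fin n, r (q.2 k.castSucc) (q.2 k.succ) then (1 : ℂ) else 0)]
    · rw [Fintype.sum_prod_type]
      simp_rw [ih, Finset.mul_sum]
      rw [Finset.sum_comm, Finset.sum_comm (γ := E)]
      refine Finset.sum_congr rfl fun f _ => ?_
      rw [Finset.sum_eq_single (f 0), Finset.sum_eq_single i]
      · simp only [relMatrix, Matrix.of_apply, true_and]
        split_ifs <;> simp_all
      · intro e _ he
        simp [he]
      · simp
      · intro e _ he
        simp [he.symm]
      · simp
    · intro q
      refine if_congr ?_ rfl rfl
      simp only [Fin.consEquiv_apply, Fin.cons_zero, ← Fin.succ_last, Fin.cons_succ,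
        Fin.forall_fin_succ, Fin.castSucc_zero, ← Fin.succ_castSucc]

/-- Powers of a 0-1 matrix count walks, and a closed walk of `n` steps unrolls to a path of period
`n`. -/
theorem trace_relMatrix_pow (r : E → E → Prop) {n : ℕ} (hn : 0 < n) :
    (relMatrix r ^ n).trace = Nat.card (PeriodicPath r n) := by
  classical
  rw [card_periodicPath r hn]
  simp only [Matrix.trace, Matrix.diag_apply, relMatrix_pow_apply]
  rw [Finset.sum_comm, ClosedWalk, Nat.card_eq_fintype_card, Fintype.card_subtype,
    Finset.card_filter]
  push_cast
  refine Finset.sum_congr rfl fun f _ => ?_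
  rw [Finset.sum_eq_single (f 0)]
  · simp [eq_comm]
  · intro e _ he
    simp [he.symm]
  · simp

/-- The Euler product over the primitive periodic orbits of a finite relation, given through
representatives `rep`. -/
theorem hasProd_primitive_orbits (r : E → E → Prop) {ι : Type*} (ℓ : ι → ℕ) (rep : ι → ℤ → E)
    (hℓ : ∀ c, 0 < ℓ c) (hrep : ∀ c k, r (rep c k) (rep c (k + 1)))
    (hper : ∀ c, Function.Periodic (rep c) (ℓ c : ℤ))
    (hmin : ∀ c (k : ℕ), 0 < k → Function.Periodic (rep c) (k : ℤ) → ℓ c ≤ k)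
    (hinj : ∀ c c' (j : ℤ), (∀ k, rep c' k = rep c (k + j)) → c = c')
    (hsurj : ∀ (p : ℤ → E) (n : ℕ), 0 < n → (∀ k, r (p k) (p (k + 1))) →
      Function.Periodic p (n : ℤ) → ∃ (c : ι) (j : ℤ), ∀ k, p k = rep c (k + j)) :
    HasProd (fun c => (1 - PowerSeries.X ^ ℓ c : ℂ⟦X⟧)) ((relMatrix r).charpolyRev : ℂ⟦X⟧) := by
  classical
  refine hasProd_one_sub_X_pow _ ℓ hℓ ?_ ?_
  · intro n
    -- Representatives of one length `m` are distinct paths of period `m` (by `hinj` with shift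
    -- zero), and there are finitely many of those.
    have h : ∀ m, {c | ℓ c = m}.Finite := by
      intro m
      rcases Nat.eq_zero_or_pos m with rfl | hm
      · convert! Set.finite_empty
        ext c
        simp [(hℓ c).ne']
      · have := finite_periodicPath r hm
        refine Finite.of_injective (β := PeriodicPath r m)
          (fun c => ⟨rep c.1, hrep c.1, by
            have := hper c.1
            rwa [c.2] at this⟩) ?_
        rintro ⟨c, hc⟩ ⟨c', hc'⟩ h
        refine Subtype.ext (hinj c c' 0 fun k => ?_)
        rw [add_zero]
        exact congrFun (congrArg Subtype.val h).symm k
    refine ((Finset.range (n + 1)).finite_toSet.biUnion fun m _ => h m).subset fun c hc => ?_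
    simpa [Nat.lt_succ_iff] using hc
  · intro n hn s hs
    rw [trace_relMatrix_pow r hn]
    -- Every path of period `n` is a shift of a unique `rep c` with `ℓ c ∣ n`, by an amount that is
    -- unique modulo `ℓ c`.
    have hcard : Nat.card (PeriodicPath r n) =
        Nat.card (Σ c : {c // c ∈ s.filter fun c => ℓ c ∣ n}, Fin (ℓ c.1)) := by
      symm
      refine Nat.card_eq_of_bijective (fun x => ⟨fun k => rep x.1.1 (k + (x.2 : ℕ)), ?_, ?_⟩)
        ⟨?_, ?_⟩
      · intro k
        change r (rep _ _) (rep _ _)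
        rw [add_right_comm]
        exact hrep _ _
      · obtain ⟨m, hm⟩ := (Finset.mem_filter.1 x.1.2).2
        have h : Function.Periodic (rep x.1.1) (n : ℤ) := by
          have h0 := (hper x.1.1).nat_mul m
          have h1 : ((n : ℕ) : ℤ) = (m : ℤ) * (ℓ x.1.1 : ℤ) := by
            exact_mod_cast hm.trans (mul_comm _ _)
          rwa [h1]
        intro k
        change rep _ _ = rep _ _
        rw [add_right_comm]
        exact h _
      · rintro ⟨⟨c, hc⟩, i⟩ ⟨⟨c', hc'⟩, j⟩ h
        have h' : ∀ k : ℤ, rep c (k + (i : ℕ)) = rep c' (k + (j : ℕ)) :=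
          fun k => congrFun (congrArg Subtype.val h) k
        have hcc : c = c' := by
          refine hinj c c' ((i : ℕ) - (j : ℕ)) fun k => ?_
          have := h' (k - (j : ℕ))
          rw [sub_add_cancel] at this
          rw [← this]
          congr 1
          ring
        subst hcc
        have hp : Function.Periodic (rep c) (((i : ℕ) : ℤ) - (j : ℕ)) := by
          intro k
          have := h' (k - (j : ℕ))
          rw [sub_add_cancel] at this
          rw [← this]
          congr 1
          ring
        have hd := dvd_of_periodic (hℓ c) (hper c) (hmin c) (periodic_natAbs hp)
        have hi := i.2
        have hj := j.2
        -- The difference of the shifts is a period of absolute value less than the minimal one,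
        -- hence zero.
        have hij : i = j := by
          have h0 : (((i : ℕ) : ℤ) - (j : ℕ)).natAbs = 0 :=
            Nat.eq_zero_of_dvd_of_lt hd (by simp only at hi hj; omega)
          exact Fin.ext (by omega)
        rw [hij]
      · rintro ⟨p, hp, hp'⟩
        obtain ⟨c, j, hc⟩ := hsurj p n hn hp hp'
        have hpc : Function.Periodic (rep c) (n : ℤ) := by
          intro k
          have h1 := hc (k - j)
          have h2 := hc (k - j + n)
          rw [hp' (k - j), h1, sub_add_cancel] at h2
          rw [h2]
          congr 1
          ring
        have hd : ℓ c ∣ n := dvd_of_periodic (hℓ c) (hper c) (hmin c) hpc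
        have hℓ' : (0 : ℤ) < ℓ c := by exact_mod_cast hℓ c
        have h1 := Int.emod_nonneg j hℓ'.ne'
        have h2 := Int.emod_lt_of_pos j hℓ'
        refine ⟨⟨⟨c, Finset.mem_filter.2 ⟨hs c (Nat.le_of_dvd hn hd), hd⟩⟩,
          ⟨(j % ℓ c).toNat, by simp only; omega⟩⟩, Subtype.ext (funext fun k => ?_)⟩
        change rep c (k + ((j % ℓ c).toNat : ℕ)) = p k
        rw [hc, Int.toNat_of_nonneg h1, ← periodic_apply_emod (hper c) (k + j),
          ← periodic_apply_emod (hper c), Int.add_emod_emod]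
    rw [hcard, Nat.card_sigma]
    simp only [Nat.card_eq_fintype_card, Fintype.card_fin]
    rw [Finset.sum_coe_sort (s.filter fun c => ℓ c ∣ n) ℓ, Finset.sum_filter]
    push_cast
    rfl

end Paths

/-! ### The non-incidence matrix of a finite projective plane -/

section ProjectivePlane

open Configuration Configuration.ofField
open scoped LinearAlgebra.Projectivization

variable {K : Type*} [Field K] [Finite K]

theorem card_projectivePlane : Nat.card (ℙ K (Fin 3 → K)) = Nat.card K ^ 2 + Nat.card K + 1 := by
  rw [Projectivization.card_of_finrank K (Fin 3 → K) (n := 3) (by simp)]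
  simp [Finset.sum_range_succ]
  ring

/-- The non-incidence matrix of the projective plane over a finite field is injective. -/
theorem eq_zero_of_sum_not_orthogonal [Fintype (ℙ K (Fin 3 → K))] (f : ℙ K (Fin 3 → K) → ℂ)
    [∀ p w : ℙ K (Fin 3 → K), Decidable (p.orthogonal w)]
    (h : ∀ w : ℙ K (Fin 3 → K), ∑ p, (if p.orthogonal w then 0 else f p) = 0) : f = 0 := by
  classical
  set q := ProjectivePlane.order (ℙ K (Fin 3 → K)) (ℙ K (Fin 3 → K)) with hq
  have hline : ∀ p : ℙ K (Fin 3 → K),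
      ((Finset.univ.filter fun w : ℙ K (Fin 3 → K) => p.orthogonal w).card : ℂ) = q + 1 := by
    intro p
    have := ProjectivePlane.lineCount_eq (P := ℙ K (Fin 3 → K)) (L := ℙ K (Fin 3 → K)) p
    rw [lineCount, Nat.card_eq_fintype_card, Fintype.card_subtype] at this
    rw [hq]
    exact_mod_cast this
  have hcard : (Fintype.card (ℙ K (Fin 3 → K)) : ℂ) = q ^ 2 + q + 1 := by
    have := ProjectivePlane.card_points (ℙ K (Fin 3 → K)) (ℙ K (Fin 3 → K))
    exact_mod_cast this
  have hq0 : (q : ℂ) ≠ 0 := by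
    have := ProjectivePlane.one_lt_order (ℙ K (Fin 3 → K)) (ℙ K (Fin 3 → K))
    exact_mod_cast (by omega : q ≠ 0)
  -- Summing the hypothesis over all lines counts each point `q ^ 2` times, the number of lines that
  -- miss it.
  have hsum : ∑ p, f p = 0 := by
    have h1 : ∑ w : ℙ K (Fin 3 → K), ∑ p, (if p.orthogonal w then 0 else f p) = 0 :=
      Finset.sum_eq_zero fun w _ => h w
    rw [Finset.sum_comm] at h1
    have h2 : ∀ p : ℙ K (Fin 3 → K),
        ∑ w, (if p.orthogonal w then 0 else f p) = (q : ℂ) ^ 2 * f p := by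
      intro p
      have h3 : ∀ w, (if p.orthogonal w then 0 else f p)
          = f p - (if p.orthogonal w then f p else 0) := fun w => by split_ifs <;> simp
      simp_rw [h3]
      rw [Finset.sum_sub_distrib, ← Finset.sum_filter, Finset.sum_const, Finset.sum_const,
        nsmul_eq_mul, nsmul_eq_mul, hline, Finset.card_univ, hcard]
      ring
    simp_rw [h2] at h1
    rw [← Finset.mul_sum] at h1
    exact (mul_eq_zero.1 h1).resolve_left (pow_ne_zero 2 hq0)
  have hinc : ∀ w : ℙ K (Fin 3 → K), ∑ p, (if p.orthogonal w then f p else 0) = 0 := by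
    intro w
    have h3 : ∀ p, (if p.orthogonal w then f p else 0)
        = f p - (if p.orthogonal w then 0 else f p) := fun p => by split_ifs <;> simp
    simp_rw [h3]
    rw [Finset.sum_sub_distrib, hsum, h w, sub_zero]
  funext p
  -- Summing over the `q + 1` lines through `p` counts `p` itself `q + 1` times and every other
  -- point once, which isolates `q f(p)`.
  have h1 : ∑ w ∈ Finset.univ.filter (fun w : ℙ K (Fin 3 → K) => p.orthogonal w),
      ∑ p', (if p'.orthogonal w then f p' else 0) = 0 := Finset.sum_eq_zero fun w _ => hinc w
  rw [Finset.sum_comm] at h1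
  have h2 : ∀ p', ∑ w ∈ Finset.univ.filter (fun w : ℙ K (Fin 3 → K) => p.orthogonal w),
      (if p'.orthogonal w then f p' else 0) = f p' + if p' = p then (q : ℂ) * f p else 0 := by
    intro p'
    rw [← Finset.sum_filter, Finset.filter_filter, Finset.sum_const, nsmul_eq_mul]
    by_cases hp : p' = p
    · subst hp
      simp only [and_self, if_true]
      rw [hline]
      ring
    · rw [if_neg hp, add_zero]
      obtain ⟨w, hw, hw'⟩ := HasLines.existsUnique_line (ℙ K (Fin 3 → K)) (ℙ K (Fin 3 → K)) p p'
        (Ne.symm hp)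
      rw [show (Finset.univ.filter fun w : ℙ K (Fin 3 → K) => p.orthogonal w ∧ p'.orthogonal w)
        = {w} from ?_]
      · simp
      · ext x
        simp only [Finset.mem_filter, Finset.mem_univ, true_and, Finset.mem_singleton]
        exact ⟨fun hx => hw' x hx, fun hx => hx ▸ hw⟩
  simp_rw [h2] at h1
  rw [Finset.sum_add_distrib, hsum, zero_add, Finset.sum_ite_eq' Finset.univ p] at h1
  simpa [hq0] using h1

end ProjectivePlane

/-! ### Lattices and vertices as cosets of matrices -/

section LatticeMatrix

variable {F : Type*} [Field F] [ValuativeRel F]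

variable (F) in
/-- The lattice `𝒪³`. -/
def stdLattice : Lattice F := latticeOfBasis (Pi.basisFun F (Fin 3))

variable (F) in
/-- The class of `𝒪³`. -/
def origin : Vertex F := (stdLattice F).toVertex

theorem mem_stdLattice {v : Fin 3 → F} : v ∈ (stdLattice F).1 ↔ ∀ i, v i ∈ 𝒪[F] := by
  change v ∈ Submodule.span 𝒪[F] (Set.range (Pi.basisFun F (Fin 3))) ↔ _
  rw [Submodule.mem_span_range_iff_exists_fun]
  constructor
  · rintro ⟨c, rfl⟩ i
    simp only [Pi.basisFun_apply, Finset.sum_apply, Pi.smul_apply]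
    refine Subring.sum_mem _ fun j _ => ?_
    rw [Pi.single_apply]
    split_ifs
    · simp [Subring.smul_def]
    · simp
  · intro h
    refine ⟨fun i => ⟨v i, h i⟩, ?_⟩
    ext i
    simp [Finset.sum_apply, Pi.single_apply, Subring.smul_def]

theorem smul_lattice_mono (g : GL (Fin 3) F) {Λ Λ' : Lattice F} (h : Λ.1 ≤ Λ'.1) :
    (g • Λ).1 ≤ (g • Λ').1 := Submodule.map_mono h

theorem smul_lattice_le_iff (g : GL (Fin 3) F) {Λ Λ' : Lattice F} :
    (g • Λ).1 ≤ (g • Λ').1 ↔ Λ.1 ≤ Λ'.1 := by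
  refine ⟨fun h => ?_, smul_lattice_mono g⟩
  simpa only [inv_smul_smul] using smul_lattice_mono g⁻¹ h

/-- A matrix with entries in the valuation ring. -/
def IsInt (M : Matrix (Fin 3) (Fin 3) F) : Prop := ∀ i j, M i j ∈ 𝒪[F]

theorem IsInt.det {M : Matrix (Fin 3) (Fin 3) F} (hM : IsInt M) : M.det ∈ 𝒪[F] := by
  rw [Matrix.det_apply]
  refine Subring.sum_mem _ fun σ _ => ?_
  rw [Units.smul_def]
  exact Subring.zsmul_mem _ (Subring.prod_mem _ fun i _ => hM _ _) _

theorem smul_stdLattice_le {g : GL (Fin 3) F} : (g • stdLattice F).1 ≤ (stdLattice F).1 ↔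
    IsInt (g : Matrix (Fin 3) (Fin 3) F) := by
  constructor
  · intro h i j
    have h1 : (g : Matrix (Fin 3) (Fin 3) F).mulVec (Pi.single j 1) ∈ (g • stdLattice F).1 := by
      refine ⟨Pi.single j 1, mem_stdLattice.2 fun k => ?_, rfl⟩
      rw [Pi.single_apply]
      split_ifs
      · exact Subring.one_mem _
      · exact Subring.zero_mem _
    simpa using mem_stdLattice.1 (h h1) i
  · rintro h _ ⟨w, hw, rfl⟩
    refine mem_stdLattice.2 fun i => ?_
    rw [glMap_apply, Matrix.mulVec, dotProduct]
    exact Subring.sum_mem _ fun k _ => Subring.mul_mem _ (h i k) (mem_stdLattice.1 hw k)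

theorem smul_stdLattice_le_smul {g h : GL (Fin 3) F} :
    (g • stdLattice F).1 ≤ (h • stdLattice F).1 ↔ IsInt (h⁻¹ * g).1 := by
  rw [← smul_stdLattice_le, ← smul_lattice_le_iff h⁻¹, inv_smul_smul, mul_smul]

theorem smul_stdLattice_eq {g : GL (Fin 3) F} :
    g • stdLattice F = stdLattice F ↔ IsInt g.1 ∧ IsInt (g⁻¹).1 := by
  constructor
  · intro h
    refine ⟨smul_stdLattice_le.1 (by rw [h]), smul_stdLattice_le.1 ?_⟩
    conv_lhs => rw [← h, inv_smul_smul]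
  · rintro ⟨h1, h2⟩
    refine Subtype.ext (le_antisymm (smul_stdLattice_le.2 h1) ?_)
    have := smul_stdLattice_le_smul (g := 1) (h := g)
    rw [one_smul, mul_one] at this
    exact this.2 h2

/-- The condition `α ∈ 𝒪ˣ`. -/
def IsIntUnit (α : Fˣ) : Prop := (α : F) ∈ 𝒪[F] ∧ ((α⁻¹ : Fˣ) : F) ∈ 𝒪[F]

/-- Cramer's rule: the adjugate is integral and the determinant is a unit of `𝒪`. -/
theorem isInt_inv_of_det {g : GL (Fin 3) F} (hg : IsInt g.1)
    (hd : IsIntUnit (Matrix.GeneralLinearGroup.det g)) : IsInt (g⁻¹).1 := by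
  intro i j
  rw [Matrix.coe_units_inv, Matrix.inv_def, Matrix.smul_apply, smul_eq_mul]
  refine Subring.mul_mem _ ?_ ?_
  · have := hd.2
    rwa [Units.val_inv_eq_inv_val, Matrix.GeneralLinearGroup.val_det_apply,
      ← Ring.inverse_eq_inv'] at this
  · rw [Matrix.adjugate_apply]
    refine IsInt.det fun k l => ?_
    rw [Matrix.updateRow_apply]
    split_ifs
    · rw [Pi.single_apply]
      split_ifs
      · exact Subring.one_mem _
      · exact Subring.zero_mem _
    · exact hg k l

theorem isIntUnit_det {g : GL (Fin 3) F} (hg : IsInt g.1) (hg' : IsInt (g⁻¹).1) :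
    IsIntUnit (Matrix.GeneralLinearGroup.det g) := by
  refine ⟨?_, ?_⟩
  · rw [Matrix.GeneralLinearGroup.val_det_apply]
    exact hg.det
  · rw [← map_inv, Matrix.GeneralLinearGroup.val_det_apply]
    exact hg'.det

theorem toVertex_eq_iff {Λ Λ' : Lattice F} :
    Λ.toVertex = Λ'.toVertex ↔ ∃ α : Fˣ, Λ' = Λ.scale α :=
  Quotient.eq (r := homothety F)

theorem smul_origin (g : GL (Fin 3) F) : g • origin F = (g • stdLattice F).toVertex := rfl

/-- The diagonal matrices. -/
def diagGL : (Fin 3 → Fˣ) →* GL (Fin 3) F :=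
  (Units.map (Matrix.diagonalRingHom (Fin 3) F).toMonoidHom).comp
    (MulEquiv.piUnits (M := fun _ : Fin 3 => F)).symm.toMonoidHom

omit [ValuativeRel F] in
theorem diagGL_val (w : Fin 3 → Fˣ) :
    (diagGL w).1 = Matrix.diagonal fun i => (w i : F) := rfl

omit [ValuativeRel F] in
theorem diagGL_const (α : Fˣ) :
    diagGL (fun _ => α) = Matrix.GeneralLinearGroup.scalar (Fin 3) α := by
  refine Units.ext ?_
  rw [diagGL_val]
  rfl

omit [ValuativeRel F] in
theorem det_diagGL (w : Fin 3 → Fˣ) :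
    Matrix.GeneralLinearGroup.det (diagGL w) = w 0 * w 1 * w 2 := by
  refine Units.ext ?_
  rw [Matrix.GeneralLinearGroup.val_det_apply, diagGL_val, Matrix.det_diagonal, Fin.prod_univ_three]
  simp

theorem scale_eq (α : Fˣ) (g : GL (Fin 3) F) (Λ : Lattice F) :
    Lattice.scale α (g • Λ) = (g * diagGL fun _ => α) • Λ := by
  rw [mul_smul, diagGL_const, ← smul_scale]
  rfl

theorem diagGL_smul_eq {w : Fin 3 → Fˣ} (hw : ∀ i, IsIntUnit (w i)) :
    diagGL w • stdLattice F = stdLattice F := by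
  rw [smul_stdLattice_eq, ← map_inv, diagGL_val, diagGL_val]
  constructor
  all_goals
    intro i j
    rw [Matrix.diagonal_apply]
    split_ifs
    · first | exact (hw i).1 | exact (hw i).2
    · exact Subring.zero_mem _

/-- The stabilizer of the lattice `𝒪³` is `GL₃(𝒪)`; passing to homothety classes adds the scalars.
-/
theorem smul_origin_eq_iff {g h : GL (Fin 3) F} :
    g • origin F = h • origin F ↔ ∃ α : Fˣ, IsInt (diagGL (fun _ => α) * (g⁻¹ * h)).1 ∧
      IsInt (diagGL (fun _ => α) * (g⁻¹ * h))⁻¹.1 := by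
  have key : ∀ α : Fˣ, h • stdLattice F = Lattice.scale α (g • stdLattice F) ↔
      IsInt (diagGL (fun _ => α⁻¹) * (g⁻¹ * h)).1 ∧
      IsInt (diagGL (fun _ => α⁻¹) * (g⁻¹ * h))⁻¹.1 := by
    intro α
    have e : (diagGL fun _ => α⁻¹) = (diagGL fun _ => α)⁻¹ := by rw [← map_inv]; rfl
    rw [← smul_stdLattice_eq, scale_eq, e, ← mul_assoc, ← mul_inv_rev, mul_smul _ h,
      inv_smul_eq_iff]
  rw [smul_origin, smul_origin, toVertex_eq_iff]
  constructor
  · rintro ⟨α, h⟩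
    exact ⟨α⁻¹, (key α).1 h⟩
  · rintro ⟨α, h⟩
    refine ⟨α⁻¹, (key α⁻¹).2 ?_⟩
    simpa using h

theorem smul_origin_eq_of_isInt {g h : GL (Fin 3) F} (h1 : IsInt (g⁻¹ * h).1)
    (h2 : IsInt (g⁻¹ * h)⁻¹.1) : g • origin F = h • origin F := by
  refine smul_origin_eq_iff.2 ⟨1, ?_⟩
  have : (diagGL fun _ => (1 : Fˣ)) = 1 := map_one diagGL
  rw [this, one_mul]
  exact ⟨h1, h2⟩

end LatticeMatrix

/-! ### Apartments, and adapted bases from the Smith normal form -/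

section Bases

variable {F : Type*} [Field F] [ValuativeRel F]

/-- The matrix whose columns are a basis. -/
def basisGL (b : Module.Basis (Fin 3) F (Fin 3 → F)) : GL (Fin 3) F :=
  ⟨(Pi.basisFun F (Fin 3)).toMatrix b, b.toMatrix (Pi.basisFun F (Fin 3)),
    Module.Basis.toMatrix_mul_toMatrix_flip _ _, Module.Basis.toMatrix_mul_toMatrix_flip _ _⟩

omit [ValuativeRel F] in
theorem basisGL_mulVec_single (b : Module.Basis (Fin 3) F (Fin 3 → F)) (j : Fin 3) :
    (basisGL b).1.mulVec (Pi.single j 1) = b j := by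
  ext i
  simp [basisGL, Module.Basis.toMatrix_apply]

theorem latticeOfBasis_eq_of {b b' : Module.Basis (Fin 3) F (Fin 3 → F)} {g : GL (Fin 3) F}
    (h : ∀ j, b' j = g.1.mulVec (b j)) : latticeOfBasis b' = g • latticeOfBasis b := by
  refine Subtype.ext ?_
  change Submodule.span _ _ = (Submodule.span _ _).map _
  rw [Submodule.map_span, ← Set.range_comp]
  congr 2
  funext j
  exact h j

theorem latticeOfBasis_eq (b : Module.Basis (Fin 3) F (Fin 3 → F)) :
    latticeOfBasis b = basisGL b • stdLattice F :=
  latticeOfBasis_eq_of fun j => by rw [Pi.basisFun_apply, basisGL_mulVec_single]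

theorem latticeOfBasis_unitsSMul (b : Module.Basis (Fin 3) F (Fin 3 → F)) (w : Fin 3 → Fˣ) :
    latticeOfBasis (b.unitsSMul w) = (basisGL b * diagGL w) • stdLattice F := by
  refine latticeOfBasis_eq_of fun j => ?_
  rw [Pi.basisFun_apply, Units.val_mul, ← Matrix.mulVec_mulVec, diagGL_val,
    Matrix.diagonal_mulVec_single, Module.Basis.unitsSMul_apply, mul_one]
  have : (Pi.single j ((w j : Fˣ) : F) : Fin 3 → F) = (w j : F) • Pi.single j (1 : F) := by
    rw [← Pi.single_smul]
    simp
  rw [this, Matrix.mulVec_smul, basisGL_mulVec_single]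
  rfl

omit [ValuativeRel F] in
theorem exists_basisGL_eq (g : GL (Fin 3) F) : ∃ b, basisGL b = g := by
  refine ⟨(Pi.basisFun F (Fin 3)).map (Matrix.GeneralLinearGroup.toLin g).toLinearEquiv, ?_⟩
  refine Units.ext (Matrix.ext_of_mulVec_single fun j => ?_)
  rw [basisGL_mulVec_single]
  simp [LinearMap.GeneralLinearGroup.toLinearEquiv]

theorem apartmentVertex_eq (ϖ : Fˣ) (b : Module.Basis (Fin 3) F (Fin 3 → F)) (a : Fin 3 → ℤ) :
    apartmentVertex ϖ b a = (basisGL b * diagGL fun i => ϖ ^ a i) • origin F := by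
  rw [apartmentVertex, latticeOfBasis_unitsSMul, smul_origin]

theorem apartmentVertex_reindex (ϖ : Fˣ) (b : Module.Basis (Fin 3) F (Fin 3 → F))
    (e : Fin 3 ≃ Fin 3) (a : Fin 3 → ℤ) :
    apartmentVertex ϖ (b.reindex e) a = apartmentVertex ϖ b (a ∘ e) := by
  rw [apartmentVertex, apartmentVertex]
  congr 1
  refine Subtype.ext ?_
  change Submodule.span _ _ = Submodule.span _ _
  congr 1
  rw [← e.surjective.range_comp]
  congr 1
  funext j
  simp [Module.Basis.unitsSMul_apply]

theorem apartmentVertex_add_const (ϖ : Fˣ) (b : Module.Basis (Fin 3) F (Fin 3 → F))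
    (a : Fin 3 → ℤ) (n : ℤ) :
    apartmentVertex ϖ b (fun i => a i + n) = apartmentVertex ϖ b a := by
  have : (diagGL fun i => ϖ ^ (a i + n)) =
      (diagGL fun i => ϖ ^ a i) * Matrix.GeneralLinearGroup.scalar (Fin 3) (ϖ ^ n) := by
    rw [← diagGL_const, ← map_mul]
    congr 1
    funext i
    exact zpow_add _ _ _
  rw [apartmentVertex_eq, apartmentVertex_eq, this, ← mul_assoc, mul_smul, scalar_smul_vertex]

variable [IsDiscreteValuationRing 𝒪[F]]

/-- Adapted bases for a pair of lattices. -/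
theorem exists_adapted_basis {Λ₁ Λ₂ : Lattice F} (h : Λ₂.1 ≤ Λ₁.1) :
    ∃ (g : GL (Fin 3) F) (w : Fin 3 → Fˣ), Λ₁ = g • stdLattice F ∧
      Λ₂ = (g * diagGL w) • stdLattice F := by
  have := Λ₁.2
  have := Λ₂.2
  have hr1 : Module.finrank 𝒪[F] Λ₁.1 = 3 := Submodule.IsLattice.finrank_of_pi F Λ₁.1
  have hr2 : Module.finrank 𝒪[F] Λ₂.1 = 3 := Submodule.IsLattice.finrank_of_pi F Λ₂.1
  have := Submodule.IsLattice.free F Λ₁.1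
  let b0 : Module.Basis (Fin 3) 𝒪[F] Λ₁.1 := Module.finBasisOfFinrankEq _ _ hr1
  let N : Submodule 𝒪[F] Λ₁.1 := Λ₂.1.comap Λ₁.1.subtype
  -- Equal ranks give the normal form an elementary divisor for each of the three basis vectors.
  have hN : Module.finrank 𝒪[F] N = Module.finrank 𝒪[F] Λ₁.1 := by
    exact (Submodule.comapSubtypeEquivOfLe h).finrank_eq.trans (hr2.trans hr1.symm)
  obtain ⟨b', a, ab', hab⟩ := Submodule.exists_smith_normal_form_of_rank_eq b0 hN
  have ha : ∀ i, (a i : F) ≠ 0 := by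
    intro i hi
    have h0 : a i = 0 := Subtype.ext hi
    have := hab i
    rw [h0, zero_smul] at this
    exact ab'.ne_zero i (Subtype.ext this)
  let b := b'.extendOfIsLattice F
  have hb : ∀ i, b i = b' i := fun i => b'.extendOfIsLattice_apply F i
  refine ⟨basisGL b, fun i => Units.mk0 (a i : F) (ha i), ?_, ?_⟩
  · rw [← latticeOfBasis_eq]
    refine Subtype.ext ?_
    change _ = Submodule.span _ _
    have : Set.range b = Λ₁.1.subtype '' Set.range b' := by
      rw [← Set.range_comp]
      congr 1
      funext i
      exact hb i
    rw [this, ← Submodule.map_span, b'.span_eq, Submodule.map_top, Submodule.range_subtype]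
  · rw [← latticeOfBasis_unitsSMul]
    refine Subtype.ext ?_
    change _ = Submodule.span _ _
    have : Set.range (b.unitsSMul fun i => Units.mk0 (a i : F) (ha i)) =
        Λ₁.1.subtype '' (N.subtype '' Set.range ab') := by
      rw [← Set.range_comp, ← Set.range_comp]
      congr 1
      funext i
      rw [Module.Basis.unitsSMul_apply, hb]
      simp only [Function.comp_apply, Submodule.subtype_apply, hab]
      rfl
    rw [this, ← Submodule.map_span, ← Submodule.map_span, ab'.span_eq, Submodule.map_top,
      Submodule.range_subtype, Submodule.map_comap_subtype, inf_eq_right.2 h]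

theorem exists_smul_stdLattice (Λ : Lattice F) : ∃ g : GL (Fin 3) F, Λ = g • stdLattice F :=
  let ⟨g, _, h, _⟩ := exists_adapted_basis (le_refl Λ.1)
  ⟨g, h⟩

theorem exists_smul_origin (x : Vertex F) : ∃ g : GL (Fin 3) F, x = g • origin F := by
  induction x using Quotient.inductionOn with
  | h Λ =>
    obtain ⟨g, rfl⟩ := exists_smul_stdLattice Λ
    exact ⟨g, rfl⟩

end Bases

/-! ### The normalized valuation and the type of a vertex -/

section Ord

variable {F : Type*} [Field F] [ValuativeRel F]

theorem IsIntUnit.mul {α β : Fˣ} (hα : IsIntUnit α) (hβ : IsIntUnit β) : IsIntUnit (α * β) := by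
  refine ⟨?_, ?_⟩
  · rw [Units.val_mul]
    exact Subring.mul_mem _ hα.1 hβ.1
  · rw [mul_inv, Units.val_mul]
    exact Subring.mul_mem _ hα.2 hβ.2

theorem IsIntUnit.inv {α : Fˣ} (hα : IsIntUnit α) : IsIntUnit α⁻¹ :=
  ⟨hα.2, by rw [inv_inv]; exact hα.1⟩

theorem isIntUnit_one : IsIntUnit (1 : Fˣ) := by
  refine ⟨?_, ?_⟩
  · exact Subring.one_mem _
  · rw [inv_one]
    exact Subring.one_mem _

theorem mem_or_inv_mem (α : Fˣ) : (α : F) ∈ 𝒪[F] ∨ ((α⁻¹ : Fˣ) : F) ∈ 𝒪[F] := by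
  simp only [Valuation.mem_integer_iff, Units.val_inv_eq_inv_val, map_inv₀]
  rcases le_total (ValuativeRel.valuation F α) 1 with h | h
  · exact Or.inl h
  · exact Or.inr (inv_le_one_of_one_le₀ h)

variable {ϖ : Fˣ}

theorem IsUniformizer.mem (hϖ : IsUniformizer ϖ) : (ϖ : F) ∈ 𝒪[F] := by
  obtain ⟨π, _, h⟩ := hϖ
  rw [← h]
  exact π.2

theorem IsUniformizer.inv_not_mem (hϖ : IsUniformizer ϖ) : ((ϖ⁻¹ : Fˣ) : F) ∉ 𝒪[F] := by
  obtain ⟨π, hπ, h⟩ := hϖ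
  intro h'
  refine hπ.not_isUnit (IsUnit.of_mul_eq_one ⟨_, h'⟩ (Subtype.ext ?_))
  rw [Subring.coe_mul, h]
  simp

theorem IsUniformizer.zpow_mem_iff (hϖ : IsUniformizer ϖ) {n : ℤ} :
    ((ϖ ^ n : Fˣ) : F) ∈ 𝒪[F] ↔ 0 ≤ n := by
  constructor
  · intro h
    by_contra hn
    refine hϖ.inv_not_mem ?_
    obtain ⟨m, hm⟩ : ∃ m : ℕ, n = -(m : ℤ) - 1 := ⟨(-n - 1).toNat, by omega⟩
    have e : ϖ⁻¹ = ϖ ^ n * ϖ ^ m := by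
      rw [← zpow_natCast, ← zpow_add, hm, ← zpow_neg_one]
      congr 1
      ring
    rw [e, Units.val_mul]
    refine Subring.mul_mem _ h ?_
    rw [Units.val_pow_eq_pow_val]
    exact Subring.pow_mem _ hϖ.mem m
  · intro h
    obtain ⟨m, rfl⟩ := Int.eq_ofNat_of_zero_le h
    rw [zpow_natCast, Units.val_pow_eq_pow_val]
    exact Subring.pow_mem _ hϖ.mem m

variable [IsDiscreteValuationRing 𝒪[F]]

theorem IsUniformizer.exists_zpow (hϖ : IsUniformizer ϖ) (α : Fˣ) :
    ∃ n : ℤ, IsIntUnit (ϖ ^ (-n) * α) := by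
  have key : ∀ β : Fˣ, (β : F) ∈ 𝒪[F] → ∃ n : ℤ, IsIntUnit (ϖ ^ (-n) * β) := by
    intro β hβ
    obtain ⟨π, hπ, h⟩ := hϖ
    have hβ0 : (⟨β, hβ⟩ : 𝒪[F]) ≠ 0 := fun h0 => β.ne_zero (congrArg Subtype.val h0)
    obtain ⟨n, u, hu⟩ := IsDiscreteValuationRing.eq_unit_mul_pow_irreducible hβ0 hπ
    refine ⟨n, ?_⟩
    have e : ϖ ^ (-(n : ℤ)) * β = Units.map (𝒪[F]).subtype.toMonoidHom u := by
      refine Units.ext ?_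
      have := congrArg Subtype.val hu
      simp only [Subring.coe_mul, Subring.coe_pow, h] at this
      have h0 : (ϖ : F) ≠ 0 := ϖ.ne_zero
      simp only [zpow_neg, zpow_natCast, Units.val_mul, Units.val_inv_eq_inv_val,
        Units.val_pow_eq_pow_val, this]
      rw [mul_left_comm, inv_mul_cancel₀ (pow_ne_zero _ h0), mul_one]
      rfl
    rw [e]
    refine ⟨(u : 𝒪[F]).2, ?_⟩
    rw [← map_inv]
    exact ((u⁻¹ : 𝒪[F]ˣ) : 𝒪[F]).2
  rcases mem_or_inv_mem α with h | h
  · exact key α h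
  · obtain ⟨n, hn⟩ := key α⁻¹ h
    refine ⟨-n, ?_⟩
    have := hn.inv
    rwa [mul_inv, inv_inv, ← zpow_neg] at this

open Classical in
/-- The normalized valuation. -/
def ord (ϖ : Fˣ) (α : Fˣ) : ℤ :=
  -- The default value never occurs when `ϖ` is a uniformizer, by `IsUniformizer.exists_zpow`.
  if h : ∃ n : ℤ, IsIntUnit (ϖ ^ (-n) * α) then h.choose else 0

theorem ord_spec (hϖ : IsUniformizer ϖ) (α : Fˣ) : IsIntUnit (ϖ ^ (-ord ϖ α) * α) := by
  rw [ord, dif_pos (hϖ.exists_zpow α)]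
  exact (hϖ.exists_zpow α).choose_spec

theorem ord_eq (hϖ : IsUniformizer ϖ) {α : Fˣ} {n : ℤ} (h : IsIntUnit (ϖ ^ (-n) * α)) :
    ord ϖ α = n := by
  have h1 := h.mul (ord_spec hϖ α).inv
  have e : ϖ ^ (-n) * α * (ϖ ^ (-ord ϖ α) * α)⁻¹ = ϖ ^ (ord ϖ α - n) := by
    rw [mul_inv, mul_mul_mul_comm, mul_inv_cancel, mul_one, ← zpow_neg, ← zpow_add]
    congr 1
    ring
  rw [e] at h1
  have h2 := hϖ.zpow_mem_iff.1 h1.1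
  have h3 := h1.2
  rw [← zpow_neg, hϖ.zpow_mem_iff] at h3
  omega

theorem ord_mul (hϖ : IsUniformizer ϖ) (α β : Fˣ) : ord ϖ (α * β) = ord ϖ α + ord ϖ β := by
  refine ord_eq hϖ ?_
  rw [neg_add, zpow_add, mul_mul_mul_comm]
  exact (ord_spec hϖ α).mul (ord_spec hϖ β)

theorem ord_zpow_self (hϖ : IsUniformizer ϖ) (n : ℤ) : ord ϖ (ϖ ^ n) = n := by
  refine ord_eq hϖ ?_
  rw [← zpow_add, neg_add_cancel, zpow_zero]
  exact isIntUnit_one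

theorem ord_self (hϖ : IsUniformizer ϖ) : ord ϖ ϖ = 1 := by
  simpa using ord_zpow_self hϖ 1

theorem ord_of_isIntUnit (hϖ : IsUniformizer ϖ) {α : Fˣ} (h : IsIntUnit α) : ord ϖ α = 0 := by
  refine ord_eq hϖ ?_
  rwa [neg_zero, zpow_zero, one_mul]

theorem ord_inv (hϖ : IsUniformizer ϖ) (α : Fˣ) : ord ϖ α⁻¹ = -ord ϖ α := by
  have := ord_mul hϖ α α⁻¹
  rw [mul_inv_cancel, ord_of_isIntUnit hϖ isIntUnit_one] at this
  omega

theorem mem_iff_ord_nonneg (hϖ : IsUniformizer ϖ) (α : Fˣ) :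
    (α : F) ∈ 𝒪[F] ↔ 0 ≤ ord ϖ α := by
  have h := ord_spec hϖ α
  rw [← hϖ.zpow_mem_iff]
  constructor
  · intro h1
    have e : ϖ ^ ord ϖ α = (ϖ ^ (-ord ϖ α) * α)⁻¹ * α := by
      rw [mul_inv, zpow_neg, inv_inv, inv_mul_cancel_right]
    rw [e, Units.val_mul]
    exact Subring.mul_mem _ h.2 h1
  · intro h1
    have e : α = ϖ ^ ord ϖ α * (ϖ ^ (-ord ϖ α) * α) := by
      rw [zpow_neg, mul_inv_cancel_left]
    rw [e, Units.val_mul]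
    exact Subring.mul_mem _ h1 h.1

theorem isIntUnit_iff_ord (hϖ : IsUniformizer ϖ) (α : Fˣ) : IsIntUnit α ↔ ord ϖ α = 0 := by
  rw [IsIntUnit, mem_iff_ord_nonneg hϖ, mem_iff_ord_nonneg hϖ, ord_inv hϖ]
  omega

/-- The valuation of the determinant. -/
def ordDet (ϖ : Fˣ) (g : GL (Fin 3) F) : ℤ := ord ϖ (Matrix.GeneralLinearGroup.det g)

theorem ordDet_mul (hϖ : IsUniformizer ϖ) (g h : GL (Fin 3) F) :
    ordDet ϖ (g * h) = ordDet ϖ g + ordDet ϖ h := by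
  rw [ordDet, map_mul, ord_mul hϖ]; rfl

theorem ordDet_inv (hϖ : IsUniformizer ϖ) (g : GL (Fin 3) F) :
    ordDet ϖ g⁻¹ = -ordDet ϖ g := by
  rw [ordDet, map_inv, ord_inv hϖ]; rfl

theorem ordDet_diagGL (hϖ : IsUniformizer ϖ) (w : Fin 3 → Fˣ) :
    ordDet ϖ (diagGL w) = ord ϖ (w 0) + ord ϖ (w 1) + ord ϖ (w 2) := by
  rw [ordDet, det_diagGL, ord_mul hϖ, ord_mul hϖ]

/-- The type of a vertex is well defined. -/
theorem ordDet_congr (hϖ : IsUniformizer ϖ) {g h : GL (Fin 3) F}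
    (e : g • origin F = h • origin F) : (3 : ℤ) ∣ ordDet ϖ h - ordDet ϖ g := by
  obtain ⟨α, h1, h2⟩ := smul_origin_eq_iff.1 e
  have h3 := ord_of_isIntUnit hϖ (isIntUnit_det h1 h2)
  change ordDet ϖ _ = 0 at h3
  rw [ordDet_mul hϖ, ordDet_mul hϖ, ordDet_inv hϖ, ordDet_diagGL hϖ] at h3
  exact ⟨-ord ϖ α, by linarith⟩

end Ord

/-! ### Positive edges and rank-one geodesics as standard lines -/

section Edges

variable {F : Type*} [Field F] [ValuativeRel F] {ϖ : Fˣ}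

/-- The diagonal matrix `diag (1, 1, ϖ)`. -/
def stepGL (ϖ : Fˣ) : GL (Fin 3) F := diagGL ![1, 1, ϖ]

omit [ValuativeRel F] in
theorem stepGL_zpow (ϖ : Fˣ) (k : ℤ) : stepGL ϖ ^ k = diagGL ![1, 1, ϖ ^ k] := by
  rw [stepGL, ← map_zpow]
  congr 1
  funext i
  fin_cases i <;> simp

/-- The standard line of the apartment of `g`, in positive direction. -/
def line (ϖ : Fˣ) (g : GL (Fin 3) F) (k : ℤ) : Vertex F := (g * stepGL ϖ ^ k) • origin F

theorem line_mul (g h : GL (Fin 3) F) (k : ℤ) : line ϖ (g * h) k = g • line ϖ h k := by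
  rw [line, line, mul_assoc, mul_smul]

theorem line_mul_stepGL_zpow (g : GL (Fin 3) F) (k l : ℤ) :
    line ϖ (g * stepGL ϖ ^ l) k = line ϖ g (l + k) := by
  rw [line, line, mul_assoc, zpow_add]

theorem line_zero (g : GL (Fin 3) F) : line ϖ g 0 = g • origin F := by
  rw [line, zpow_zero, mul_one]

theorem smul_adj {x y : Vertex F} (g : GL (Fin 3) F) (h : Adj ϖ x y) : Adj ϖ (g • x) (g • y) := by
  obtain ⟨hne, Λ₁, Λ₂, rfl, rfl, h1, h2⟩ := h
  refine ⟨fun e => hne (smul_left_cancel g e), g • Λ₁, g • Λ₂, rfl, rfl, ?_,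
    smul_lattice_mono g h2⟩
  rw [← smul_scale]
  exact smul_lattice_mono g h1

variable [IsDiscreteValuationRing 𝒪[F]]

theorem isInt_diagGL (hϖ : IsUniformizer ϖ) (w : Fin 3 → Fˣ) :
    IsInt (diagGL w).1 ↔ ∀ i, 0 ≤ ord ϖ (w i) := by
  constructor
  · intro h i
    have := h i i
    rwa [diagGL_val, Matrix.diagonal_apply_eq, mem_iff_ord_nonneg hϖ] at this
  · intro h i j
    rw [diagGL_val, Matrix.diagonal_apply]
    split_ifs
    · exact (mem_iff_ord_nonneg hϖ _).2 (h i)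
    · exact Subring.zero_mem _

theorem diagGL_smul_stdLattice_congr (hϖ : IsUniformizer ϖ) {w w' : Fin 3 → Fˣ}
    (h : ∀ i, ord ϖ (w i) = ord ϖ (w' i)) : diagGL w • stdLattice F = diagGL w' • stdLattice F := by
  rw [← inv_smul_eq_iff, ← mul_smul, ← map_inv, ← map_mul]
  refine diagGL_smul_eq fun i => (isIntUnit_iff_ord hϖ _).2 ?_
  change ord ϖ ((w' i)⁻¹ * w i) = 0
  rw [ord_mul hϖ, ord_inv hϖ, h i]
  ring

/-- The valuation of the determinant modulo 3 is the only obstruction: a power of `ϖ`, acting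
trivially as a scalar, removes a multiple of 3, and the unit left over is absorbed by a diagonal
matrix in `GL₃(𝒪)`. -/
theorem hasType_iff (hϖ : IsUniformizer ϖ) (g : GL (Fin 3) F) (j : Fin 3) :
    HasType ϖ (g • origin F) j ↔ (3 : ℤ) ∣ ordDet ϖ g - j := by
  set a : Fin 3 → ℤ := (![![0, 0, 0], ![0, 0, 1], ![0, 1, 1]] : Fin 3 → Fin 3 → ℤ) j with ha
  have hbasis : basisGL (Pi.basisFun F (Fin 3)) = 1 := by
    refine Units.ext ?_
    simp [basisGL]
  have hstd : standardVertex ϖ j = (diagGL fun i => ϖ ^ a i) • origin F := by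
    rw [standardVertex, apartmentVertex_eq, hbasis, one_mul]
  have hdet : ordDet ϖ (diagGL fun i => ϖ ^ a i) = j := by
    rw [ordDet_diagGL hϖ, ord_zpow_self hϖ, ord_zpow_self hϖ, ord_zpow_self hϖ, ha]
    fin_cases j <;> simp
  rw [HasType, hstd]
  constructor
  · rintro ⟨s, hs⟩
    have hs' : g • origin F =
        (Matrix.SpecialLinearGroup.toGL s * diagGL fun i => ϖ ^ a i) • origin F := by
      rw [hs, mul_smul]
      rfl
    have h := ordDet_congr hϖ hs'
    have h0 : ordDet ϖ (Matrix.SpecialLinearGroup.toGL s) = 0 := by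
      have : Matrix.GeneralLinearGroup.det (Matrix.SpecialLinearGroup.toGL s) = 1 :=
        Units.ext (by simp)
      rw [ordDet, this, ord_of_isIntUnit hϖ isIntUnit_one]
    rw [ordDet_mul hϖ, h0, hdet, zero_add] at h
    rw [← dvd_neg, neg_sub]
    exact h
  · rintro ⟨m, hm⟩
    -- The scalar `ϖ ^ (-m)` makes this determinant a unit, and `u` is chosen to bring it to 1.
    set u : Fˣ := (Matrix.GeneralLinearGroup.det (g * (diagGL fun i => ϖ ^ a i)⁻¹ *
      diagGL fun _ => ϖ ^ (-m)))⁻¹ with hu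
    have hu0 : IsIntUnit u := by
      refine IsIntUnit.inv ((isIntUnit_iff_ord hϖ _).2 ?_)
      change ordDet ϖ _ = 0
      rw [ordDet_mul hϖ, ordDet_mul hϖ, ordDet_inv hϖ, hdet, ordDet_diagGL hϖ, ord_zpow_self hϖ]
      linarith
    set s : GL (Fin 3) F := g * (diagGL fun i => ϖ ^ a i)⁻¹ * (diagGL fun _ => ϖ ^ (-m)) *
      diagGL ![u, 1, 1] with hs
    have hsdet : Matrix.GeneralLinearGroup.det s = 1 := by
      rw [hs, map_mul, ← inv_inv (Matrix.GeneralLinearGroup.det (_ * _ * _)), ← hu, det_diagGL]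
      simp
    refine ⟨⟨s.1, by
      rw [← Matrix.GeneralLinearGroup.val_det_apply, hsdet, Units.val_one]⟩, ?_⟩
    have e : s • (diagGL fun i => ϖ ^ a i) • origin F = g • origin F := by
      have e1 : s * (diagGL fun i => ϖ ^ a i) =
          g * diagGL ![u, 1, 1] * Matrix.GeneralLinearGroup.scalar (Fin 3) (ϖ ^ (-m)) := by
        rw [hs, ← diagGL_const, ← map_inv]
        simp only [mul_assoc, ← map_mul]
        congr 2
        funext i
        simp only [Pi.mul_apply, Pi.inv_apply]
        rw [mul_comm, mul_assoc, mul_assoc]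
        rw [mul_comm (ϖ ^ (-m)), mul_assoc, mul_inv_cancel, one_mul]
      rw [← mul_smul, e1, mul_smul, scalar_smul_vertex, mul_smul]
      congr 1
      rw [smul_origin, diagGL_smul_eq]
      · rfl
      · intro i
        fin_cases i
        · exact hu0
        · exact isIntUnit_one
        · exact isIntUnit_one
    rw [← e]
    rfl

theorem ordDet_stepGL (hϖ : IsUniformizer ϖ) : ordDet ϖ (stepGL ϖ) = 1 := by
  have h1 := ord_of_isIntUnit hϖ (isIntUnit_one (F := F))
  rw [stepGL, ordDet_diagGL hϖ]
  simp [h1, ord_self hϖ]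

theorem posAdj_line (hϖ : IsUniformizer ϖ) (g : GL (Fin 3) F) :
    PosAdj ϖ (g • origin F) ((g * stepGL ϖ) • origin F) := by
  have h1 := ord_of_isIntUnit hϖ (isIntUnit_one (F := F))
  refine ⟨?_, ?_⟩
  · rw [mul_smul]
    refine smul_adj g ⟨fun e => ?_, stdLattice F, stepGL ϖ • stdLattice F, rfl, rfl, ?_, ?_⟩
    · have := ordDet_congr (g := 1) (h := stepGL ϖ) hϖ ((one_smul _ _).trans e)
      rw [ordDet_stepGL hϖ, ordDet, map_one, h1] at this
      norm_num at this
    · rw [← one_smul (GL (Fin 3) F) (stdLattice F), scale_eq, one_mul, one_smul, smul_stdLattice_le_smul,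
        stepGL, ← map_inv, ← map_mul, isInt_diagGL hϖ]
      intro i
      fin_cases i <;> simp [h1, ord_self hϖ]
    · rw [smul_stdLattice_le, stepGL, isInt_diagGL hϖ]
      intro i
      fin_cases i <;> simp [h1, ord_self hϖ]
  · have h3 : ordDet ϖ (g * stepGL ϖ) = ordDet ϖ g + 1 := by rw [ordDet_mul hϖ, ordDet_stepGL hϖ]
    simp only [hasType_iff hϖ, h3]
    rcases (by omega : ordDet ϖ g % 3 = 0 ∨ ordDet ϖ g % 3 = 1 ∨ ordDet ϖ g % 3 = 2) with h | h | h
    · exact ⟨0, by simp; omega, by simp; omega⟩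
    · exact ⟨1, by simp; omega, by simp; omega⟩
    · exact ⟨2, by simp; omega, by simp; omega⟩

theorem exists_perm (n : Fin 3 → ℤ) (h0 : ∀ i, 0 ≤ n i) (h : n 0 + n 1 + n 2 = 1) :
    ∃ e : Fin 3 ≃ Fin 3, n = ![0, 0, 1] ∘ e := by
  have h2 : n = ![0, 0, 1] ∨ n = ![0, 1, 0] ∨ n = ![1, 0, 0] := by
    have h0 := h0 0
    have h1 := ‹∀ i, 0 ≤ n i› 1
    have h2 := ‹∀ i, 0 ≤ n i› 2
    have e : n = ![n 0, n 1, n 2] := by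
      funext i
      fin_cases i <;> rfl
    rcases (by omega : (n 0 = 0 ∧ n 1 = 0 ∧ n 2 = 1) ∨ (n 0 = 0 ∧ n 1 = 1 ∧ n 2 = 0) ∨
      (n 0 = 1 ∧ n 1 = 0 ∧ n 2 = 0)) with ⟨a, b, c⟩ | ⟨a, b, c⟩ | ⟨a, b, c⟩ <;>
    · rw [e, a, b, c]
      simp
  rcases h2 with rfl | rfl | rfl
  · exact ⟨Equiv.refl _, rfl⟩
  · refine ⟨Equiv.swap 1 2, ?_⟩
    decide
  · refine ⟨Equiv.swap 0 2, ?_⟩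
    decide

omit [IsDiscreteValuationRing 𝒪[F]] in
theorem apartmentVertex_line (b : Module.Basis (Fin 3) F (Fin 3 → F)) (e : Fin 3 ≃ Fin 3)
    (a : Fin 3 → ℤ) (k : ℤ) :
    apartmentVertex ϖ b (a + k • (![0, 0, 1] ∘ e)) =
      line ϖ (basisGL (b.reindex e) * diagGL fun i => ϖ ^ a (e.symm i)) k := by
  have : a + k • (![0, 0, 1] ∘ e) = (a ∘ e.symm + k • ![0, 0, 1]) ∘ e := by
    funext i
    simp only [Pi.add_apply, Pi.smul_apply, Function.comp_apply, Equiv.symm_apply_apply]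
  rw [this, ← apartmentVertex_reindex, apartmentVertex_eq, line, stepGL_zpow, mul_assoc, ← map_mul]
  congr 3
  funext i
  fin_cases i <;> simp [zpow_add]

/-- In an adapted basis the exponents of `Λ₂` relative to `Λ₁` are 0 or 1. The types force their sum
to be 1 modulo 3, so exactly one exponent is 1, and a permutation of the basis moves it to the last
place. Thus `GL₃(F)` acts transitively on positive edges. -/
theorem posAdj_iff (hϖ : IsUniformizer ϖ) {x y : Vertex F} :
    PosAdj ϖ x y ↔ ∃ g : GL (Fin 3) F, x = g • origin F ∧ y = (g * stepGL ϖ) • origin F := by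
  refine ⟨?_, fun ⟨g, hx, hy⟩ => hx ▸ hy ▸ posAdj_line hϖ g⟩
  rintro ⟨⟨_, Λ₁, Λ₂, rfl, rfl, h1, h2⟩, j, ht, ht'⟩
  obtain ⟨g, w, rfl, rfl⟩ := exists_adapted_basis h2
  rw [← smul_origin, hasType_iff hϖ] at ht ht'
  rw [ordDet_mul hϖ, ordDet_diagGL hϖ] at ht'
  rw [smul_stdLattice_le_smul, inv_mul_cancel_left, isInt_diagGL hϖ] at h2
  rw [scale_eq, smul_stdLattice_le_smul, mul_inv_rev, mul_assoc, inv_mul_cancel_left, ← map_inv,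
    ← map_mul, isInt_diagGL hϖ] at h1
  have h3 : ∀ i, ord ϖ (w i) ≤ 1 := by
    intro i
    have := h1 i
    rw [Pi.mul_apply, Pi.inv_apply, ord_mul hϖ, ord_inv hϖ, ord_self hϖ] at this
    linarith
  have hsum : ord ϖ (w 0) + ord ϖ (w 1) + ord ϖ (w 2) = 1 := by
    have a0 := h2 0
    have a1 := h2 1
    have a2 := h2 2
    have b0 := h3 0
    have b1 := h3 1
    have b2 := h3 2
    -- Addition in `Fin 3` wraps around; both cases agree modulo 3.
    have hj : ((j + 1 : Fin 3) : ℤ) = ((j : ℕ) + 1 : ℤ) ∨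
        ((j + 1 : Fin 3) : ℤ) = ((j : ℕ) + 1 : ℤ) - 3 := by
      fin_cases j <;> simp
    omega
  obtain ⟨e, he⟩ := exists_perm (fun i => ord ϖ (w i)) h2 hsum
  obtain ⟨b, rfl⟩ := exists_basisGL_eq g
  have l0 := apartmentVertex_line (ϖ := ϖ) b e 0 0
  have l1 := apartmentVertex_line (ϖ := ϖ) b e 0 1
  rw [line, apartmentVertex_eq] at l0 l1
  rw [zpow_zero, mul_one] at l0
  rw [zpow_one] at l1
  refine ⟨_, Eq.trans ?_ l0, Eq.trans ?_ l1⟩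
  · have : (diagGL fun i => ϖ ^ ((0 : Fin 3 → ℤ) + (0 : ℤ) • ((![0, 0, 1] : Fin 3 → ℤ) ∘ e)) i) = 1 := by
      rw [← map_one diagGL]
      congr 1
      funext i
      simp
    rw [this, mul_one, smul_origin]
  · rw [smul_origin, mul_smul, mul_smul]
    congr 2
    refine diagGL_smul_stdLattice_congr hϖ fun i => ?_
    rw [congrFun he i, ord_zpow_self hϖ]
    simp

/-- Going there and back would raise the type by 2, which is not 0 modulo 3. -/
theorem PosAdj.asymm (hϖ : IsUniformizer ϖ) {x y : Vertex F} (h : PosAdj ϖ x y) :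
    ¬ PosAdj ϖ y x := by
  intro h'
  obtain ⟨g, rfl, rfl⟩ := (posAdj_iff hϖ).1 h
  obtain ⟨g', h1, h2⟩ := (posAdj_iff hϖ).1 h'
  have e1 := ordDet_congr hϖ h1
  have e2 := ordDet_congr hϖ h2
  rw [ordDet_mul hϖ, ordDet_stepGL hϖ] at e1 e2
  omega

theorem PosAdj.smul (hϖ : IsUniformizer ϖ) {x y : Vertex F} (h : PosAdj ϖ x y)
    (g : GL (Fin 3) F) : PosAdj ϖ (g • x) (g • y) := by
  obtain ⟨g', rfl, rfl⟩ := (posAdj_iff hϖ).1 h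
  exact (posAdj_iff hϖ).2 ⟨g * g', by rw [mul_smul], by rw [mul_assoc, mul_smul g]⟩

theorem posAdj_line_succ (hϖ : IsUniformizer ϖ) (g : GL (Fin 3) F) (k : ℤ) :
    PosAdj ϖ (line ϖ g k) (line ϖ g (k + 1)) :=
  (posAdj_iff hϖ).2 ⟨_, rfl, by rw [line, mul_assoc, ← zpow_add_one]⟩

omit [IsDiscreteValuationRing 𝒪[F]] in
theorem Adj.symm {x y : Vertex F} (h : Adj ϖ x y) : Adj ϖ y x := by
  obtain ⟨hne, Λ₁, Λ₂, rfl, rfl, h1, h2⟩ := h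
  refine ⟨hne.symm, Λ₂, Λ₁.scale ϖ, rfl, (toVertex_eq_iff.2 ⟨ϖ, rfl⟩).symm,
    smul_lattice_mono _ h2, h1⟩

/-- The rank-one geodesics are the standard lines in the apartments, in one of the two
directions. -/
theorem isRankOneGeodesic_iff (hϖ : IsUniformizer ϖ) (c : ℤ → Vertex F) :
    IsRankOneGeodesic ϖ c ↔ ∃ g : GL (Fin 3) F,
      (∀ k, c k = line ϖ g k) ∨ (∀ k, c k = line ϖ g (-k)) := by
  constructor
  · rintro ⟨⟨b, a, v, hc⟩, hadj⟩
    obtain ⟨hne, Λ₁, Λ₂, h1, h2, h3, h4⟩ := hadj 0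
    rw [zero_add] at hne h2
    have hc0 : c 0 = (basisGL b * diagGL fun i => ϖ ^ a i) • origin F := by
      rw [hc 0, zero_smul, add_zero, apartmentVertex_eq]
    have hc1 : c 1 = (basisGL b * diagGL fun i => ϖ ^ (a + v) i) • origin F := by
      rw [hc 1, one_smul, apartmentVertex_eq]
    rw [hc0, smul_origin, eq_comm, toVertex_eq_iff] at h1
    rw [hc1, smul_origin, eq_comm, toVertex_eq_iff] at h2
    obtain ⟨α, rfl⟩ := h1
    obtain ⟨β, rfl⟩ := h2
    rw [scale_eq, scale_eq, mul_assoc, mul_assoc, ← map_mul, ← map_mul, smul_stdLattice_le_smul,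
      mul_inv_rev, mul_assoc, inv_mul_cancel_left, ← map_inv, ← map_mul, isInt_diagGL hϖ] at h4
    rw [scale_eq, scale_eq, scale_eq, mul_assoc, mul_assoc, mul_assoc, ← map_mul, ← map_mul,
      ← map_mul, smul_stdLattice_le_smul,
      mul_inv_rev, mul_assoc, inv_mul_cancel_left, ← map_inv, ← map_mul, isInt_diagGL hϖ] at h3
    set n := ord ϖ β - ord ϖ α with hn
    have h5 : ∀ i, 0 ≤ v i + n := by
      intro i
      have := h4 i
      simp only [Pi.mul_apply, Pi.inv_apply, Pi.add_apply, ord_mul hϖ, ord_inv hϖ,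
        ord_zpow_self hϖ] at this
      linarith
    have h6 : ∀ i, v i + n ≤ 1 := by
      intro i
      have := h3 i
      simp only [Pi.mul_apply, Pi.inv_apply, Pi.add_apply, ord_mul hϖ, ord_inv hϖ,
        ord_zpow_self hϖ, ord_self hϖ] at this
      linarith
    -- In an apartment the direction `v` matters only modulo `(1, 1, 1)`.
    have hc' : ∀ m k : ℤ, c k = apartmentVertex ϖ b (a + k • fun i => v i + m) := by
      intro m k
      rw [hc, ← apartmentVertex_add_const ϖ b _ (k * m)]
      congr 1
      funext i
      simp
      ring
    have h7 : ¬ (v 0 + n = v 1 + n ∧ v 1 + n = v 2 + n) := by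
      rintro ⟨e1, e2⟩
      refine hne ?_
      rw [hc' (-v 0) 0, hc' (-v 0) 1]
      congr 1
      have : (fun i => v i + -v 0) = 0 := by
        funext i
        fin_cases i <;> simp <;> omega
      rw [this]
      simp
    have a0 := h5 0
    have a1 := h5 1
    have a2 := h5 2
    have b0 := h6 0
    have b1 := h6 1
    have b2 := h6 2
    -- The normalized direction has entries 0 and 1, not all equal. A single 1 gives a standard
    -- line; with two, subtracting `(1, 1, 1)` leaves a single `-1`, a standard line run backwards.
    rcases (by omega : (v 0 + n) + (v 1 + n) + (v 2 + n) = 1 ∨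
      (v 0 + n) + (v 1 + n) + (v 2 + n) = 2) with h | h
    · obtain ⟨e, he⟩ := exists_perm (fun i => v i + n) h5 h
      exact ⟨_, Or.inl fun k => by rw [hc' n k, he, apartmentVertex_line]⟩
    · obtain ⟨e, he⟩ := exists_perm (fun i => -(v i + (n - 1))) (fun i => by
        have := h6 i
        linarith) (by linarith)
      refine ⟨basisGL (b.reindex e) * diagGL fun i => ϖ ^ a (e.symm i), Or.inr fun k => ?_⟩
      rw [← apartmentVertex_line b e a, ← he, hc' (n - 1) k]
      congr 2
      funext i
      simp only [Pi.smul_apply, smul_eq_mul]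
      ring
  · have key : ∀ g : GL (Fin 3) F, ∃ (b : Module.Basis (Fin 3) F (Fin 3 → F)), ∀ k : ℤ,
        line ϖ g k = apartmentVertex ϖ b (k • ![0, 0, 1]) := by
      intro g
      obtain ⟨b, rfl⟩ := exists_basisGL_eq g
      refine ⟨b, fun k => ?_⟩
      rw [apartmentVertex_eq, line, stepGL_zpow]
      congr 3
      funext i
      fin_cases i <;> simp
    rintro ⟨g, h | h⟩
    · obtain ⟨b, hb⟩ := key g
      refine ⟨⟨b, 0, ![0, 0, 1], fun k => by rw [h, hb, zero_add]⟩, fun k => ?_⟩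
      rw [h, h]
      exact (posAdj_line_succ hϖ g k).1
    · obtain ⟨b, hb⟩ := key g
      refine ⟨⟨b, 0, -![0, 0, 1], fun k => by rw [h, hb, zero_add, smul_neg, neg_smul]⟩,
        fun k => ?_⟩
      rw [h, h]
      have := (posAdj_line_succ hϖ g (-(k + 1))).1.symm
      rwa [neg_add, neg_add_cancel_right, ← neg_add] at this

end Edges

/-! ### The action of `GL₃(𝒪)` on the lines through a vertex -/

section Integral

variable {F : Type*} [Field F] [ValuativeRel F] {ϖ : Fˣ}

variable (F) in
/-- The inclusion of `GL₃(𝒪)` in `GL₃(F)`. -/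
def inclGL : GL (Fin 3) 𝒪[F] →* GL (Fin 3) F := Matrix.GeneralLinearGroup.map (𝒪[F]).subtype

theorem inclGL_apply (Q : GL (Fin 3) 𝒪[F]) (i j : Fin 3) :
    (inclGL F Q).1 i j = (Q.1 i j : F) := rfl

theorem inclGL_inv_val (Q : GL (Fin 3) 𝒪[F]) : (inclGL F Q)⁻¹.1 = (inclGL F Q⁻¹).1 := by
  rw [← map_inv]

theorem isInt_inclGL (Q : GL (Fin 3) 𝒪[F]) : IsInt (inclGL F Q).1 := fun i j => (Q.1 i j).2

theorem isInt_inclGL_inv (Q : GL (Fin 3) 𝒪[F]) : IsInt (inclGL F Q)⁻¹.1 := by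
  rw [inclGL_inv_val]
  exact isInt_inclGL Q⁻¹

theorem inclGL_smul_origin (Q : GL (Fin 3) 𝒪[F]) : inclGL F Q • origin F = origin F := by
  rw [smul_origin, smul_stdLattice_eq.2 ⟨isInt_inclGL Q, isInt_inclGL_inv Q⟩]
  rfl

theorem exists_inclGL_eq {g : GL (Fin 3) F} (h1 : IsInt g.1) (h2 : IsInt (g⁻¹).1) :
    ∃ Q, inclGL F Q = g := by
  refine ⟨⟨Matrix.of fun i j => ⟨g.1 i j, h1 i j⟩, Matrix.of fun i j => ⟨(g⁻¹).1 i j, h2 i j⟩,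
    ?_, ?_⟩, Units.ext rfl⟩
  · ext i j
    have h := congrFun (congrFun g.mul_inv i) j
    simp only [Matrix.mul_apply, Matrix.of_apply, AddSubmonoidClass.coe_finsetSum,
      Subring.coe_mul] at h ⊢
    refine h.trans ?_
    simp only [Matrix.one_apply]
    split_ifs <;> rfl
  · ext i j
    have h := congrFun (congrFun g.inv_mul i) j
    simp only [Matrix.mul_apply, Matrix.of_apply, AddSubmonoidClass.coe_finsetSum,
      Subring.coe_mul] at h ⊢
    refine h.trans ?_
    simp only [Matrix.one_apply]
    split_ifs <;> rfl

theorem line_mul_scalar (g : GL (Fin 3) F) (α : Fˣ) (k : ℤ) :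
    line ϖ (g * diagGL fun _ => α) k = line ϖ g k := by
  have h : (diagGL fun _ => α) * stepGL ϖ ^ k = stepGL ϖ ^ k * diagGL fun _ => α := by
    rw [stepGL_zpow, ← map_mul, ← map_mul, mul_comm]
  rw [line, line, mul_assoc, h, ← mul_assoc, mul_smul, diagGL_const, scalar_smul_vertex]

/-- Two matrices with the same vertex differ by an element of `GL₃(𝒪)`, up to scalars. -/
theorem exists_inclGL_of_smul_origin_eq {g g' : GL (Fin 3) F}
    (h : g • origin F = g' • origin F) :
    ∃ Q : GL (Fin 3) 𝒪[F], ∀ (ϖ : Fˣ) (k : ℤ), line ϖ g' k = line ϖ (g * inclGL F Q) k := by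
  obtain ⟨α, h1, h2⟩ := smul_origin_eq_iff.1 h
  obtain ⟨Q, hQ⟩ := exists_inclGL_eq h1 h2
  refine ⟨Q, fun ϖ k => ?_⟩
  rw [hQ, diagGL_const]
  have : g * (Matrix.GeneralLinearGroup.scalar (Fin 3) α * (g⁻¹ * g')) =
      g' * Matrix.GeneralLinearGroup.scalar (Fin 3) α := by
    have hc : ∀ x : GL (Fin 3) F, Matrix.GeneralLinearGroup.scalar (Fin 3) α * x =
        x * Matrix.GeneralLinearGroup.scalar (Fin 3) α := by
      intro x
      ext i j
      simp [Matrix.GeneralLinearGroup.scalar, mul_comm]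
    rw [hc, ← mul_assoc, mul_inv_cancel_left]
  rw [this, ← diagGL_const, line_mul_scalar]

omit [ValuativeRel F] in
theorem conj_stepGL_apply (M : GL (Fin 3) F) (k : ℤ) (i j : Fin 3) :
    ((stepGL ϖ ^ k)⁻¹ * M * stepGL ϖ ^ k).1 i j =
      ((((![1, 1, ϖ ^ k] i)⁻¹ * ![1, 1, ϖ ^ k] j : Fˣ)) : F) * M.1 i j := by
  rw [stepGL_zpow, ← map_inv, Units.val_mul, Units.val_mul, diagGL_val, diagGL_val,
    Matrix.mul_diagonal, Matrix.diagonal_mul, Units.val_mul, Pi.inv_apply]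
  ring

/-- Conjugation by `stepGL ϖ ^ k` multiplies the last row of `Q` by `ϖ ^ (-k)` and the last column
by `ϖ ^ k`, up to the corner, and keeps the determinant. If the result is integral, it lies in
`GL₃(𝒪)` and fixes the origin. -/
theorem line_mul_inclGL {g : GL (Fin 3) F} {Q : GL (Fin 3) 𝒪[F]} {k : ℤ}
    (hrow : ∀ j, j ≠ 2 → ((ϖ ^ (-k) : Fˣ) : F) * Q.1 2 j ∈ 𝒪[F])
    (hcol : ∀ i, i ≠ 2 → ((ϖ ^ k : Fˣ) : F) * Q.1 i 2 ∈ 𝒪[F]) :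
    line ϖ (g * inclGL F Q) k = line ϖ g k := by
  symm
  have e : (g * stepGL ϖ ^ k)⁻¹ * (g * inclGL F Q * stepGL ϖ ^ k) =
      (stepGL ϖ ^ k)⁻¹ * inclGL F Q * stepGL ϖ ^ k := by group
  have h1 : IsInt ((stepGL ϖ ^ k)⁻¹ * inclGL F Q * stepGL ϖ ^ k).1 := by
    intro i j
    rw [conj_stepGL_apply, inclGL_apply]
    have hrow0 := hrow 0 (by decide)
    have hrow1 := hrow 1 (by decide)
    have hcol0 := hcol 0 (by decide)
    have hcol1 := hcol 1 (by decide)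
    fin_cases i <;> fin_cases j <;> simp_all
  refine smul_origin_eq_of_isInt ?_ ?_ <;> rw [e]
  · exact h1
  · refine isInt_inv_of_det h1 ?_
    rw [map_mul, map_mul, mul_comm, map_inv, mul_inv_cancel_left]
    exact isIntUnit_det (isInt_inclGL Q) (isInt_inclGL_inv Q)

variable [IsDiscreteValuationRing 𝒪[F]]

/-- Equality of vertices gives integrality only up to a scalar; comparing determinants shows that
this scalar is a unit. -/
theorem isInt_of_line_mul_inclGL_eq (hϖ : IsUniformizer ϖ) {g : GL (Fin 3) F}
    {Q : GL (Fin 3) 𝒪[F]} {k : ℤ} (h : line ϖ (g * inclGL F Q) k = line ϖ g k) :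
    IsInt ((stepGL ϖ ^ k)⁻¹ * inclGL F Q * stepGL ϖ ^ k).1 := by
  obtain ⟨α, h1, h2⟩ := smul_origin_eq_iff.1 h.symm
  have e : (g * stepGL ϖ ^ k)⁻¹ * (g * inclGL F Q * stepGL ϖ ^ k) =
      (stepGL ϖ ^ k)⁻¹ * inclGL F Q * stepGL ϖ ^ k := by group
  rw [e] at h1 h2
  have h3 := ord_of_isIntUnit hϖ (isIntUnit_det h1 h2)
  have h4 := ord_of_isIntUnit hϖ (isIntUnit_det (isInt_inclGL Q) (isInt_inclGL_inv Q))
  change ordDet ϖ _ = 0 at h3 h4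
  rw [ordDet_mul hϖ, ordDet_mul hϖ, ordDet_mul hϖ, ordDet_inv hϖ, ordDet_diagGL hϖ, h4] at h3
  have h5 : IsIntUnit α := (isIntUnit_iff_ord hϖ α).2 (by linarith)
  intro i j
  have h6 := h1 i j
  rw [Units.val_mul, diagGL_val, Matrix.diagonal_mul] at h6
  have h7 := Subring.mul_mem _ h5.2 h6
  rwa [← mul_assoc, ← Units.val_mul, inv_mul_cancel, Units.val_one, one_mul] at h7

theorem IsUniformizer.inv_mul_mem_iff (hϖ : IsUniformizer ϖ) (x : 𝒪[F]) :
    ((ϖ⁻¹ : Fˣ) : F) * x ∈ 𝒪[F] ↔ x ∈ 𝓂[F] := by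
  obtain ⟨π, hπ, h⟩ := hϖ
  rw [hπ.maximalIdeal_eq, Ideal.mem_span_singleton]
  constructor
  · intro hx
    refine ⟨⟨_, hx⟩, Subtype.ext ?_⟩
    rw [Subring.coe_mul, h, ← mul_assoc, ← Units.val_mul, mul_inv_cancel, Units.val_one, one_mul]
  · rintro ⟨y, rfl⟩
    rw [Subring.coe_mul, h, ← mul_assoc, ← Units.val_mul, inv_mul_cancel, Units.val_one, one_mul]
    exact y.2

/-- At `k = 1` the column condition is automatic, and divisibility of the last row by `ϖ` remains.
The next vertex thus depends only on the last row modulo `𝓂[F]`; at `k = -1` rows and columns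
exchange roles. -/
theorem line_one_mul_inclGL_iff (hϖ : IsUniformizer ϖ) (g : GL (Fin 3) F) (Q : GL (Fin 3) 𝒪[F]) :
    line ϖ (g * inclGL F Q) 1 = line ϖ g 1 ↔ Q.1 2 0 ∈ 𝓂[F] ∧ Q.1 2 1 ∈ 𝓂[F] := by
  constructor
  · intro h
    have h1 := isInt_of_line_mul_inclGL_eq hϖ h
    have h20 := h1 2 0
    have h21 := h1 2 1
    rw [conj_stepGL_apply, inclGL_apply] at h20 h21
    rw [← hϖ.inv_mul_mem_iff, ← hϖ.inv_mul_mem_iff]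
    exact ⟨by simpa using h20, by simpa using h21⟩
  · rintro ⟨h0, h1⟩
    refine line_mul_inclGL (fun j hj => ?_) fun i _ => ?_
    · rw [zpow_neg, zpow_one]
      rw [← hϖ.inv_mul_mem_iff] at h0 h1
      fin_cases j
      · exact h0
      · exact h1
      · exact absurd rfl hj
    · rw [zpow_one]
      exact Subring.mul_mem _ hϖ.mem (Q.1 i 2).2

theorem line_neg_one_mul_inclGL_iff (hϖ : IsUniformizer ϖ) (g : GL (Fin 3) F)
    (Q : GL (Fin 3) 𝒪[F]) :
    line ϖ (g * inclGL F Q) (-1) = line ϖ g (-1) ↔ Q.1 0 2 ∈ 𝓂[F] ∧ Q.1 1 2 ∈ 𝓂[F] := by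
  constructor
  · intro h
    have h1 := isInt_of_line_mul_inclGL_eq hϖ h
    have h20 := h1 0 2
    have h21 := h1 1 2
    rw [conj_stepGL_apply, inclGL_apply] at h20 h21
    rw [← hϖ.inv_mul_mem_iff, ← hϖ.inv_mul_mem_iff]
    exact ⟨by simpa using h20, by simpa using h21⟩
  · rintro ⟨h0, h1⟩
    refine line_mul_inclGL (fun j _ => ?_) fun i hi => ?_
    · rw [neg_neg, zpow_one]
      exact Subring.mul_mem _ hϖ.mem (Q.1 2 j).2
    · rw [zpow_neg, zpow_one]
      rw [← hϖ.inv_mul_mem_iff] at h0 h1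
      fin_cases i
      · exact h0
      · exact h1
      · exact absurd rfl hi

end Integral

/-! ### Unipotent matrices for block elimination -/

section Unipotent

variable {R : Type*} [CommRing R]

/-- The unipotent matrices with last row `(s, t, 1)`. -/
def lowGL (s t : R) : GL (Fin 3) R :=
  ⟨!![1, 0, 0; 0, 1, 0; s, t, 1], !![1, 0, 0; 0, 1, 0; -s, -t, 1],
    by ext i j; fin_cases i <;> fin_cases j <;> simp [Matrix.mul_apply, Fin.sum_univ_three],
    by ext i j; fin_cases i <;> fin_cases j <;> simp [Matrix.mul_apply, Fin.sum_univ_three]⟩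

/-- The unipotent matrices with last column `(s, t, 1)`. -/
def upGL (s t : R) : GL (Fin 3) R :=
  ⟨!![1, 0, s; 0, 1, t; 0, 0, 1], !![1, 0, -s; 0, 1, -t; 0, 0, 1],
    by ext i j; fin_cases i <;> fin_cases j <;> simp [Matrix.mul_apply, Fin.sum_univ_three],
    by ext i j; fin_cases i <;> fin_cases j <;> simp [Matrix.mul_apply, Fin.sum_univ_three]⟩

theorem lowGL_inv_mul_apply (s t : R) (P : GL (Fin 3) R) (j : Fin 3) :
    ((lowGL s t)⁻¹ * P).1 2 j = P.1 2 j - s * P.1 0 j - t * P.1 1 j := by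
  change (!![1, 0, 0; 0, 1, 0; -s, -t, 1] * P.1) 2 j = _
  simp [Matrix.mul_apply, Fin.sum_univ_three]
  ring

theorem upGL_inv_mul_apply_zero (s t : R) (P : GL (Fin 3) R) (j : Fin 3) :
    ((upGL s t)⁻¹ * P).1 0 j = P.1 0 j - s * P.1 2 j := by
  change (!![1, 0, -s; 0, 1, -t; 0, 0, 1] * P.1) 0 j = _
  simp [Matrix.mul_apply, Fin.sum_univ_three]
  ring

theorem upGL_inv_mul_apply_one (s t : R) (P : GL (Fin 3) R) (j : Fin 3) :
    ((upGL s t)⁻¹ * P).1 1 j = P.1 1 j - t * P.1 2 j := by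
  change (!![1, 0, -s; 0, 1, -t; 0, 0, 1] * P.1) 1 j = _
  simp [Matrix.mul_apply, Fin.sum_univ_three]
  ring

/-- Modulo the maximal ideal `P` is block triangular, so its determinant is the product of the two
diagonal blocks. -/
theorem isUnit_minors [IsLocalRing R] (P : GL (Fin 3) R)
    (h0 : P.1 2 0 ∈ IsLocalRing.maximalIdeal R) (h1 : P.1 2 1 ∈ IsLocalRing.maximalIdeal R) :
    IsUnit (P.1 0 0 * P.1 1 1 - P.1 0 1 * P.1 1 0) ∧ IsUnit (P.1 2 2) := by
  have hdet : IsUnit P.1.det := (Matrix.isUnit_iff_isUnit_det _).1 P.isUnit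
  rw [Matrix.det_fin_three] at hdet
  have hm : P.1 2 0 * (P.1 0 1 * P.1 1 2 - P.1 0 2 * P.1 1 1) +
      P.1 2 1 * (P.1 0 2 * P.1 1 0 - P.1 0 0 * P.1 1 2) ∈ IsLocalRing.maximalIdeal R :=
    Ideal.add_mem _ (Ideal.mul_mem_right _ _ h0) (Ideal.mul_mem_right _ _ h1)
  have h : IsUnit ((P.1 0 0 * P.1 1 1 - P.1 0 1 * P.1 1 0) * P.1 2 2) := by
    by_contra hn
    have h3 := Ideal.add_mem _ ((IsLocalRing.mem_maximalIdeal _).2 hn) hm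
    refine (IsLocalRing.mem_maximalIdeal _).1 h3 ?_
    convert! hdet using 1
    ring
  exact IsUnit.mul_iff.1 h

end Unipotent

/-! ### Splicing two lines that share an edge -/

section Extension

variable {F : Type*} [Field F] [ValuativeRel F] [IsDiscreteValuationRing 𝒪[F]] {ϖ : Fˣ}

/-- Up to scalars `g' = g P` with `P` in `GL₃(𝒪)`, and the common edge puts the first two entries of
the last row of `P` in `𝓂[F]`. Factor `P = lowGL s t * P'` with those entries of `P'` zero. Then `s,
t ∈ 𝓂[F]`, so `lowGL s t` preserves the line of `g` up to `k = 1`, while `P'` does not change the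
line at `k = 2`. -/
theorem exists_line_extend_right (hϖ : IsUniformizer ϖ) {g g' : GL (Fin 3) F}
    (h0 : line ϖ g 0 = line ϖ g' 0) (h1 : line ϖ g 1 = line ϖ g' 1) :
    ∃ h : GL (Fin 3) F, (∀ k ≤ 1, line ϖ h k = line ϖ g k) ∧ line ϖ h 2 = line ϖ g' 2 := by
  rw [line_zero, line_zero] at h0
  obtain ⟨P, hP⟩ := exists_inclGL_of_smul_origin_eq h0
  rw [hP, eq_comm, line_one_mul_inclGL_iff hϖ] at h1
  obtain ⟨⟨Δ, hΔ⟩, -⟩ := isUnit_minors P h1.1 h1.2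
  -- `(s, t)` times the upper left block of `P` is the last row; this is Cramer's solution.
  set s := (P.1 2 0 * P.1 1 1 - P.1 2 1 * P.1 1 0) * ((Δ⁻¹ : 𝒪[F]ˣ) : 𝒪[F]) with hs
  set t := (P.1 2 1 * P.1 0 0 - P.1 2 0 * P.1 0 1) * ((Δ⁻¹ : 𝒪[F]ˣ) : 𝒪[F]) with ht
  have hs' : s ∈ 𝓂[F] := Ideal.mul_mem_right _ _
    (Ideal.sub_mem _ (Ideal.mul_mem_right _ _ h1.1) (Ideal.mul_mem_right _ _ h1.2))
  have ht' : t ∈ 𝓂[F] := Ideal.mul_mem_right _ _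
    (Ideal.sub_mem _ (Ideal.mul_mem_right _ _ h1.2) (Ideal.mul_mem_right _ _ h1.1))
  have hΔ' : (Δ : 𝒪[F]) * ((Δ⁻¹ : 𝒪[F]ˣ) : 𝒪[F]) = 1 := Δ.mul_inv
  refine ⟨g * inclGL F (lowGL s t), fun k hk => line_mul_inclGL (fun j hj => ?_) fun i hi => ?_, ?_⟩
  · have e : ((ϖ ^ (-k) : Fˣ) : F) = ((ϖ ^ (1 - k) : Fˣ) : F) * ((ϖ⁻¹ : Fˣ) : F) := by
      rw [← Units.val_mul, ← zpow_neg_one, ← zpow_add]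
      congr 2
      ring
    rw [e, mul_assoc]
    refine Subring.mul_mem _ (hϖ.zpow_mem_iff.2 (by omega)) ((hϖ.inv_mul_mem_iff _).2 ?_)
    fin_cases j
    · exact hs'
    · exact ht'
    · exact absurd rfl hj
  · have : (lowGL s t).1 i 2 = 0 := by
      fin_cases i
      · rfl
      · rfl
      · exact absurd rfl hi
    rw [this]
    simp
  · rw [hP, ← mul_inv_cancel_left (lowGL s t) P, map_mul, ← mul_assoc]
    symm
    refine line_mul_inclGL (fun j hj => ?_) fun i _ => ?_
    · have : ((lowGL s t)⁻¹ * P).1 2 j = 0 := by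
        rw [lowGL_inv_mul_apply]
        fin_cases j
        · simp only [hs, ht]
          simp only [Fin.zero_eta]
          linear_combination (-P.1 2 0) * hΔ' + P.1 2 0 * ((Δ⁻¹ : 𝒪[F]ˣ) : 𝒪[F]) * hΔ
        · simp only [hs, ht]
          simp only [Fin.mk_one]
          linear_combination (-P.1 2 1) * hΔ' + P.1 2 1 * ((Δ⁻¹ : 𝒪[F]ˣ) : 𝒪[F]) * hΔ
        · exact absurd rfl hj
      rw [this]
      simp
    · exact Subring.mul_mem _ (hϖ.zpow_mem_iff.2 (by norm_num)) (Subtype.prop _)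

/-- Here the last column of `P` is cleared with the unit corner entry. The factor `upGL s t`
preserves the whole half-line `k ≥ 0`, and the cleared factor does not change the vertex at `-1`. -/
theorem exists_line_extend_left (hϖ : IsUniformizer ϖ) {g g' : GL (Fin 3) F}
    (h0 : line ϖ g 0 = line ϖ g' 0) (h1 : line ϖ g 1 = line ϖ g' 1) :
    ∃ h : GL (Fin 3) F, (∀ k, 0 ≤ k → line ϖ h k = line ϖ g k) ∧
      line ϖ h (-1) = line ϖ g' (-1) := by
  rw [line_zero, line_zero] at h0
  obtain ⟨P, hP⟩ := exists_inclGL_of_smul_origin_eq h0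
  rw [hP, eq_comm, line_one_mul_inclGL_iff hϖ] at h1
  obtain ⟨-, ⟨δ, hδ⟩⟩ := isUnit_minors P h1.1 h1.2
  have hδ' : ((δ⁻¹ : 𝒪[F]ˣ) : 𝒪[F]) * P.1 2 2 = 1 := by rw [← hδ, Units.inv_mul]
  set s := P.1 0 2 * ((δ⁻¹ : 𝒪[F]ˣ) : 𝒪[F]) with hs
  set t := P.1 1 2 * ((δ⁻¹ : 𝒪[F]ˣ) : 𝒪[F]) with ht
  refine ⟨g * inclGL F (upGL s t), fun k hk => line_mul_inclGL (fun j hj => ?_) fun i _ => ?_, ?_⟩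
  · have : (upGL s t).1 2 j = 0 := by
      fin_cases j
      · rfl
      · rfl
      · exact absurd rfl hj
    rw [this]
    simp
  · exact Subring.mul_mem _ (hϖ.zpow_mem_iff.2 hk) (Subtype.prop _)
  · rw [hP, ← mul_inv_cancel_left (upGL s t) P, map_mul, ← mul_assoc]
    symm
    refine (line_neg_one_mul_inclGL_iff hϖ _ _).2 ?_
    rw [upGL_inv_mul_apply_zero, upGL_inv_mul_apply_one, hs, ht, mul_assoc, hδ', mul_assoc, hδ',
      mul_one, mul_one, sub_self, sub_self]
    exact ⟨Ideal.zero_mem _, Ideal.zero_mem _⟩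

theorem exists_line_extend_right_at (hϖ : IsUniformizer ϖ) {g g' : GL (Fin 3) F} {n : ℤ}
    (h0 : line ϖ g n = line ϖ g' n) (h1 : line ϖ g (n + 1) = line ϖ g' (n + 1)) :
    ∃ h : GL (Fin 3) F, (∀ k ≤ n + 1, line ϖ h k = line ϖ g k) ∧
      line ϖ h (n + 2) = line ϖ g' (n + 2) := by
  obtain ⟨h, h2, h3⟩ := exists_line_extend_right (g := g * stepGL ϖ ^ n) (g' := g' * stepGL ϖ ^ n)
    hϖ (by simpa only [line_mul_stepGL_zpow, add_zero] using h0)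
    (by simpa only [line_mul_stepGL_zpow] using h1)
  refine ⟨h * stepGL ϖ ^ (-n), fun k hk => ?_, ?_⟩
  · rw [line_mul_stepGL_zpow, h2 _ (by omega), line_mul_stepGL_zpow, add_neg_cancel_left]
  · rw [line_mul_stepGL_zpow, neg_add_cancel_left, h3, line_mul_stepGL_zpow]

theorem exists_line_extend_left_at (hϖ : IsUniformizer ϖ) {g g' : GL (Fin 3) F} {n : ℤ}
    (h0 : line ϖ g n = line ϖ g' n) (h1 : line ϖ g (n + 1) = line ϖ g' (n + 1)) :
    ∃ h : GL (Fin 3) F, (∀ k, n ≤ k → line ϖ h k = line ϖ g k) ∧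
      line ϖ h (n - 1) = line ϖ g' (n - 1) := by
  obtain ⟨h, h2, h3⟩ := exists_line_extend_left (g := g * stepGL ϖ ^ n) (g' := g' * stepGL ϖ ^ n)
    hϖ (by simpa only [line_mul_stepGL_zpow, add_zero] using h0)
    (by simpa only [line_mul_stepGL_zpow] using h1)
  refine ⟨h * stepGL ϖ ^ (-n), fun k hk => ?_, ?_⟩
  · rw [line_mul_stepGL_zpow, h2 _ (by omega), line_mul_stepGL_zpow, add_neg_cancel_left]
  · rw [line_mul_stepGL_zpow, show -n + (n - 1) = -1 by ring, h3, line_mul_stepGL_zpow]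
    rfl

end Extension

/-! ### Edges at a vertex as points and lines of a projective plane -/

section Link

open scoped LinearAlgebra.Projectivization

variable {R : Type*} [CommRing R] [IsLocalRing R]

open IsLocalRing in
theorem lastCol_ne_zero (Q : GL (Fin 3) R) : (fun i => residue R (Q.1 i 2)) ≠ 0 := by
  intro h
  have h1 : ∀ i, residue R (Q.1 i 2) = 0 := fun i => congrFun h i
  have h2 : ((Q⁻¹ * Q).1 2 2 : R) = 1 := by rw [inv_mul_cancel]; rfl
  rw [Units.val_mul, Matrix.mul_apply] at h2
  have h3 := congrArg (residue R) h2
  simp [map_sum, h1] at h3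

/-- The inverse transpose. -/
def invTranspose (Q : GL (Fin 3) R) : GL (Fin 3) R :=
  ⟨(Q⁻¹.1).transpose, Q.1.transpose, by
    rw [← Matrix.transpose_mul, ← Units.val_mul, mul_inv_cancel, Units.val_one,
      Matrix.transpose_one], by
    rw [← Matrix.transpose_mul, ← Units.val_mul, inv_mul_cancel, Units.val_one,
      Matrix.transpose_one]⟩

omit [IsLocalRing R] in
theorem invTranspose_invTranspose (Q : GL (Fin 3) R) : invTranspose (invTranspose Q) = Q :=
  Units.ext (Matrix.transpose_transpose _)

/-- The point of the projective plane over the residue field given by the last column. -/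
def colPoint (Q : GL (Fin 3) R) : ℙ (IsLocalRing.ResidueField R) (Fin 3 → IsLocalRing.ResidueField R) :=
  Projectivization.mk _ (fun i => IsLocalRing.residue R (Q.1 i 2)) (lastCol_ne_zero Q)

/-- The point of the projective plane over the residue field given by the last row of the
inverse. -/
def rowPoint (Q : GL (Fin 3) R) : ℙ (IsLocalRing.ResidueField R) (Fin 3 → IsLocalRing.ResidueField R) :=
  colPoint (invTranspose Q)

theorem colPoint_surjective : Function.Surjective (colPoint (R := R)) := by
  intro p
  induction p using Projectivization.ind with
  | h v hv =>
    choose w hw using fun i => IsLocalRing.residue_surjective (v i)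
    obtain ⟨i, hi⟩ := Function.ne_iff.1 hv
    have hwi : IsUnit (w i) := by
      rw [← IsLocalRing.residue_ne_zero_iff_isUnit, hw]
      exact hi
    have key : ∃ Q : GL (Fin 3) R, ∀ i, Q.1 i 2 = w i := by
      fin_cases i
      · refine ⟨Matrix.GeneralLinearGroup.mk'' !![0, 0, w 0; 1, 0, w 1; 0, 1, w 2] ?_, fun i => ?_⟩
        · simpa [Matrix.det_fin_three] using hwi
        · fin_cases i <;> rfl
      · refine ⟨Matrix.GeneralLinearGroup.mk'' !![1, 0, w 0; 0, 0, w 1; 0, 1, w 2] ?_, fun i => ?_⟩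
        · simpa [Matrix.det_fin_three] using hwi
        · fin_cases i <;> rfl
      · refine ⟨Matrix.GeneralLinearGroup.mk'' !![1, 0, w 0; 0, 1, w 1; 0, 0, w 2] ?_, fun i => ?_⟩
        · simpa [Matrix.det_fin_three] using hwi
        · fin_cases i <;> rfl
    obtain ⟨Q, hQ⟩ := key
    refine ⟨Q, ?_⟩
    rw [colPoint]
    congr 1
    funext i
    rw [hQ, hw]

theorem rowPoint_surjective : Function.Surjective (rowPoint (R := R)) := by
  intro p
  obtain ⟨Q, rfl⟩ := colPoint_surjective p
  exact ⟨invTranspose Q, by rw [rowPoint, invTranspose_invTranspose]⟩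

/-- `Q` is invertible over the residue field, so one may cancel it and compare the last column of
`P` with the last unit vector. -/
theorem colPoint_mul_eq (Q P : GL (Fin 3) R) : colPoint (Q * P) = colPoint Q ↔
    P.1 0 2 ∈ IsLocalRing.maximalIdeal R ∧ P.1 1 2 ∈ IsLocalRing.maximalIdeal R := by
  rw [colPoint, colPoint, Projectivization.mk_eq_mk_iff']
  have hQP : ∀ i, (Q * P).1 i 2 = Q.1 i 0 * P.1 0 2 + Q.1 i 1 * P.1 1 2 + Q.1 i 2 * P.1 2 2 := by
    intro i
    rw [Units.val_mul, Matrix.mul_apply, Fin.sum_univ_three]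
  have hP : ∀ i, P.1 i 2 = Q⁻¹.1 i 0 * (Q * P).1 0 2 + Q⁻¹.1 i 1 * (Q * P).1 1 2 +
      Q⁻¹.1 i 2 * (Q * P).1 2 2 := by
    intro i
    conv_lhs => rw [← inv_mul_cancel_left Q P]
    rw [Units.val_mul Q⁻¹, Matrix.mul_apply, Fin.sum_univ_three]
  have h1 : ∀ i, Q⁻¹.1 i 0 * Q.1 0 2 + Q⁻¹.1 i 1 * Q.1 1 2 + Q⁻¹.1 i 2 * Q.1 2 2 =
      (1 : Matrix (Fin 3) (Fin 3) R) i 2 := by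
    intro i
    rw [← Units.inv_mul Q, Matrix.mul_apply, Fin.sum_univ_three]
  simp only [← IsLocalRing.residue_eq_zero_iff]
  constructor
  · rintro ⟨a, ha⟩
    have ha' : ∀ i, IsLocalRing.residue R ((Q * P).1 i 2) = a * IsLocalRing.residue R (Q.1 i 2) :=
      fun i => (congrFun ha i).symm
    have : ∀ i, IsLocalRing.residue R (P.1 i 2) =
        a * IsLocalRing.residue R ((1 : Matrix (Fin 3) (Fin 3) R) i 2) := by
      intro i
      rw [hP, ← h1]
      simp only [map_add, map_mul, ha']
      ring
    exact ⟨by rw [this]; simp, by rw [this]; simp⟩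
  · rintro ⟨h0, h1⟩
    refine ⟨IsLocalRing.residue R (P.1 2 2), ?_⟩
    funext i
    rw [hQP]
    simp [h0, h1, mul_comm]

omit [IsLocalRing R] in
theorem invTranspose_mul (Q P : GL (Fin 3) R) :
    invTranspose (Q * P) = invTranspose Q * invTranspose P := by
  refine Units.ext ?_
  change ((Q * P)⁻¹.1).transpose = (Q⁻¹.1).transpose * (P⁻¹.1).transpose
  rw [mul_inv_rev, Units.val_mul, Matrix.transpose_mul]

theorem rowPoint_mul_eq (Q P : GL (Fin 3) R) : rowPoint (Q * P) = rowPoint Q ↔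
    P.1 2 0 ∈ IsLocalRing.maximalIdeal R ∧ P.1 2 1 ∈ IsLocalRing.maximalIdeal R := by
  -- Reading the equality backwards replaces `P` by `P⁻¹`, whose inverse transpose has the last row
  -- of `P` as its last column.
  have h : rowPoint (Q * P) = rowPoint Q ↔ rowPoint (Q * P * P⁻¹) = rowPoint (Q * P) := by
    rw [mul_inv_cancel_right, eq_comm]
  rw [h, rowPoint, rowPoint, invTranspose_mul _ P⁻¹, colPoint_mul_eq]
  change (P⁻¹⁻¹).1 2 0 ∈ _ ∧ (P⁻¹⁻¹).1 2 1 ∈ _ ↔ _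
  rw [inv_inv]

theorem colPoint_orthogonal_rowPoint (Q P : GL (Fin 3) R) :
    (colPoint Q).orthogonal (rowPoint P) ↔ (P⁻¹ * Q).1 2 2 ∈ IsLocalRing.maximalIdeal R := by
  rw [rowPoint, colPoint, colPoint, Projectivization.orthogonal_mk,
    ← IsLocalRing.residue_eq_zero_iff, Units.val_mul, Matrix.mul_apply, map_sum, dotProduct]
  have : ∀ i, (invTranspose P).1 i 2 = P⁻¹.1 2 i := fun i => rfl
  simp only [this, map_mul, mul_comm]

variable {F : Type*} [Field F] [ValuativeRel F] [IsDiscreteValuationRing 𝒪[F]] {ϖ : Fˣ}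

theorem line_one_eq_iff (hϖ : IsUniformizer ϖ) (g : GL (Fin 3) F) (Q P : GL (Fin 3) 𝒪[F]) :
    line ϖ (g * inclGL F Q) 1 = line ϖ (g * inclGL F P) 1 ↔ rowPoint Q = rowPoint P := by
  rw [← mul_inv_cancel_left P Q, map_mul, ← mul_assoc, line_one_mul_inclGL_iff hϖ,
    rowPoint_mul_eq]

theorem line_neg_one_eq_iff (hϖ : IsUniformizer ϖ) (g : GL (Fin 3) F) (Q P : GL (Fin 3) 𝒪[F]) :
    line ϖ (g * inclGL F Q) (-1) = line ϖ (g * inclGL F P) (-1) ↔ colPoint Q = colPoint P := by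
  rw [← mul_inv_cancel_left P Q, map_mul, ← mul_assoc, line_neg_one_mul_inclGL_iff hϖ,
    colPoint_mul_eq]

/-- The positively oriented edges that start at `[g 𝒪³]` correspond to the points of a projective
plane: this is the end point. -/
def outVertex (ϖ : Fˣ) (g : GL (Fin 3) F) (w : ℙ 𝓀[F] (Fin 3 → 𝓀[F])) : Vertex F :=
  line ϖ (g * inclGL F (Function.surjInv rowPoint_surjective w)) 1

/-- The positively oriented edges that end at `[g 𝒪³]` correspond to the points of a projective
plane: this is the starting point. -/
def inVertex (ϖ : Fˣ) (g : GL (Fin 3) F) (p : ℙ 𝓀[F] (Fin 3 → 𝓀[F])) : Vertex F :=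
  line ϖ (g * inclGL F (Function.surjInv colPoint_surjective p)) (-1)

theorem outVertex_rowPoint (hϖ : IsUniformizer ϖ) (g : GL (Fin 3) F) (Q : GL (Fin 3) 𝒪[F]) :
    outVertex ϖ g (rowPoint Q) = line ϖ (g * inclGL F Q) 1 :=
  (line_one_eq_iff hϖ g _ _).2 (Function.surjInv_eq _ _)

theorem inVertex_colPoint (hϖ : IsUniformizer ϖ) (g : GL (Fin 3) F) (Q : GL (Fin 3) 𝒪[F]) :
    inVertex ϖ g (colPoint Q) = line ϖ (g * inclGL F Q) (-1) :=
  (line_neg_one_eq_iff hϖ g _ _).2 (Function.surjInv_eq _ _)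

theorem outVertex_injective (hϖ : IsUniformizer ϖ) (g : GL (Fin 3) F) :
    Function.Injective (outVertex ϖ g) := by
  intro w w' h
  obtain ⟨Q, rfl⟩ := rowPoint_surjective w
  obtain ⟨P, rfl⟩ := rowPoint_surjective w'
  rw [outVertex_rowPoint hϖ, outVertex_rowPoint hϖ] at h
  exact (line_one_eq_iff hϖ g Q P).1 h

theorem inVertex_injective (hϖ : IsUniformizer ϖ) (g : GL (Fin 3) F) :
    Function.Injective (inVertex ϖ g) := by
  intro w w' h
  obtain ⟨Q, rfl⟩ := colPoint_surjective w
  obtain ⟨P, rfl⟩ := colPoint_surjective w'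
  rw [inVertex_colPoint hϖ, inVertex_colPoint hϖ] at h
  exact (line_neg_one_eq_iff hϖ g Q P).1 h

omit [IsDiscreteValuationRing 𝒪[F]] in
theorem line_mul_inclGL_zero (g : GL (Fin 3) F) (Q : GL (Fin 3) 𝒪[F]) :
    line ϖ (g * inclGL F Q) 0 = g • origin F := by
  rw [line_zero, mul_smul, inclGL_smul_origin]

theorem posAdj_smul_origin_iff (hϖ : IsUniformizer ϖ) (g : GL (Fin 3) F) (y : Vertex F) :
    PosAdj ϖ (g • origin F) y ↔ ∃ w, y = outVertex ϖ g w := by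
  constructor
  · intro h
    obtain ⟨g', h1, rfl⟩ := (posAdj_iff hϖ).1 h
    obtain ⟨Q, hQ⟩ := exists_inclGL_of_smul_origin_eq h1
    refine ⟨rowPoint Q, ?_⟩
    rw [outVertex_rowPoint hϖ, ← hQ, line, zpow_one]
  · rintro ⟨w, rfl⟩
    have := posAdj_line_succ hϖ (g * inclGL F (Function.surjInv rowPoint_surjective w)) 0
    rwa [line_mul_inclGL_zero, zero_add] at this

theorem posAdj_smul_origin_iff' (hϖ : IsUniformizer ϖ) (g : GL (Fin 3) F) (y : Vertex F) :
    PosAdj ϖ y (g • origin F) ↔ ∃ p, y = inVertex ϖ g p := by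
  constructor
  · intro h
    obtain ⟨g', rfl, h1⟩ := (posAdj_iff hϖ).1 h
    obtain ⟨Q, hQ⟩ := exists_inclGL_of_smul_origin_eq h1
    refine ⟨colPoint Q, ?_⟩
    rw [inVertex_colPoint hϖ, ← hQ, line, zpow_neg_one, mul_inv_cancel_right]
  · rintro ⟨w, rfl⟩
    have := posAdj_line_succ hϖ (g * inclGL F (Function.surjInv colPoint_surjective w)) (-1)
    rwa [neg_add_cancel, line_mul_inclGL_zero] at this

/-- Two consecutive edges are straight if and only if the corresponding point and line of the
projective plane are not incident. -/
theorem exists_line_iff (hϖ : IsUniformizer ϖ) (g : GL (Fin 3) F)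
    (p w : ℙ 𝓀[F] (Fin 3 → 𝓀[F])) :
    (∃ h : GL (Fin 3) F, line ϖ h (-1) = inVertex ϖ g p ∧ line ϖ h 0 = g • origin F ∧
      line ϖ h 1 = outVertex ϖ g w) ↔ ¬ p.orthogonal w := by
  obtain ⟨Q, rfl⟩ := colPoint_surjective p
  obtain ⟨P, rfl⟩ := rowPoint_surjective w
  rw [colPoint_orthogonal_rowPoint, inVertex_colPoint hϖ, outVertex_rowPoint hϖ]
  constructor
  · rintro ⟨h, h1, h2, h3⟩
    rw [line_zero] at h2
    obtain ⟨S, hS⟩ := exists_inclGL_of_smul_origin_eq h2.symm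
    rw [hS, line_neg_one_eq_iff hϖ] at h1
    rw [hS, line_one_eq_iff hϖ] at h3
    -- One matrix `S` gives both edges of a line, so the pairing is the corner entry of `S⁻¹ S`,
    -- which is 1.
    rw [← colPoint_orthogonal_rowPoint, ← h1, ← h3, colPoint_orthogonal_rowPoint, inv_mul_cancel]
    exact fun h => (Ideal.ne_top_iff_one _).1 (IsLocalRing.maximalIdeal.isMaximal 𝒪[F]).ne_top h
  · intro h
    rw [IsLocalRing.mem_maximalIdeal, mem_nonunits_iff, not_not] at h
    obtain ⟨δ, hδ⟩ := h
    set M := P⁻¹ * Q with hM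
    have hδ' : ((δ⁻¹ : 𝒪[F]ˣ) : 𝒪[F]) * M.1 2 2 = 1 := by rw [← hδ, Units.inv_mul]
    -- This `upGL` clears the last column of `M = P⁻¹ Q`: the product has the column point of `Q`
    -- and keeps the row point of `P`.
    refine ⟨g * inclGL F (P * upGL (M.1 0 2 * ((δ⁻¹ : 𝒪[F]ˣ) : 𝒪[F]))
      (M.1 1 2 * ((δ⁻¹ : 𝒪[F]ˣ) : 𝒪[F]))), ?_, line_mul_inclGL_zero _ _, ?_⟩
    · rw [line_neg_one_eq_iff hϖ, eq_comm]
      have e : Q = P * upGL (M.1 0 2 * ((δ⁻¹ : 𝒪[F]ˣ) : 𝒪[F]))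
          (M.1 1 2 * ((δ⁻¹ : 𝒪[F]ˣ) : 𝒪[F])) * ((upGL (M.1 0 2 * ((δ⁻¹ : 𝒪[F]ˣ) : 𝒪[F]))
          (M.1 1 2 * ((δ⁻¹ : 𝒪[F]ˣ) : 𝒪[F])))⁻¹ * M) := by
        rw [hM]
        group
      conv_lhs => rw [e]
      rw [colPoint_mul_eq, upGL_inv_mul_apply_zero, upGL_inv_mul_apply_one, mul_assoc, hδ',
        mul_assoc, hδ', mul_one, mul_one, sub_self, sub_self]
      exact ⟨Ideal.zero_mem _, Ideal.zero_mem _⟩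
    · rw [line_one_eq_iff hϖ, rowPoint_mul_eq]
      exact ⟨Ideal.zero_mem _, Ideal.zero_mem _⟩

end Link

/-! ### Open stabilizers, finiteness of the quotient and freeness -/

section Topology

variable {F : Type*} [Field F] [ValuativeRel F] [TopologicalSpace F]
  [IsNonarchimedeanLocalField F]

variable (F) in
theorem t2Space_localField : T2Space F := by
  let := IsTopologicalAddGroup.rightUniformSpace F
  have := isUniformAddGroup_of_addCommGroup (G := F)
  infer_instance

variable (F) in
theorem compactSpace_integralGL : CompactSpace (GL (Fin 3) 𝒪[F]) := by
  have := t2Space_localField F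
  have : CompactSpace (Matrix (Fin 3) (Fin 3) 𝒪[F]) :=
    inferInstanceAs (CompactSpace (Fin 3 → Fin 3 → 𝒪[F]))
  have : T1Space (Matrix (Fin 3) (Fin 3) 𝒪[F]) :=
    inferInstanceAs (T1Space (Fin 3 → Fin 3 → 𝒪[F]))
  infer_instance

omit [IsNonarchimedeanLocalField F] in
theorem continuous_inclGL : Continuous (inclGL F) := by
  refine Continuous.units_map _ ?_
  refine continuous_matrix fun i j => ?_
  exact continuous_subtype_val.comp (continuous_id.matrix_elem i j)

theorem isOpen_isInt : IsOpen {M : Matrix (Fin 3) (Fin 3) F | IsInt M} := by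
  simp only [IsInt, Set.ofPred_forall]
  refine isOpen_iInter_of_finite fun i => isOpen_iInter_of_finite fun j => ?_
  exact Valuation.isOpen_integer.preimage (continuous_id.matrix_elem i j)

/-- Stabilizers of vertices contain conjugates of the open subgroup `GL₃(𝒪)`. -/
theorem isOpen_smul_eq (y z : Vertex F) : IsOpen {g : GL (Fin 3) F | g • y = z} := by
  rw [isOpen_iff_mem_nhds]
  intro g₀ hg₀
  obtain ⟨h, rfl⟩ := exists_smul_origin y
  have ho : IsOpen {g : GL (Fin 3) F | IsInt ((g₀ * h)⁻¹ * (g * h)).1 ∧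
      IsInt ((g₀ * h)⁻¹ * (g * h))⁻¹.1} := by
    have hc : Continuous fun g : GL (Fin 3) F => (g₀ * h)⁻¹ * (g * h) := by fun_prop
    exact (isOpen_isInt.preimage (Units.continuous_val.comp hc)).inter
      (isOpen_isInt.preimage (Units.continuous_val.comp hc.inv))
  refine Filter.mem_of_superset (ho.mem_nhds ?_) fun g hg => ?_
  · simp only [Set.mem_ofPred_eq, inv_mul_cancel, inv_one]
    have : IsInt (1 : GL (Fin 3) F).1 := by
      rw [← map_one (inclGL F)]
      exact isInt_inclGL 1
    exact ⟨this, this⟩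
  · have := smul_origin_eq_of_isInt hg.1 hg.2
    rw [mul_smul, mul_smul] at this
    exact this.symm.trans hg₀

theorem isOpen_setOf_smul {α : Type*} (y : α → Vertex F) (P : (α → Vertex F) → Prop) [Finite α] :
    IsOpen {g : GL (Fin 3) F | P fun a => g • y a} := by
  rw [isOpen_iff_mem_nhds]
  intro g₀ hg₀
  have ho : IsOpen {g : GL (Fin 3) F | ∀ a, g • y a = g₀ • y a} := by
    rw [Set.ofPred_forall]
    exact isOpen_iInter_of_finite fun a => isOpen_smul_eq _ _
  refine Filter.mem_of_superset (ho.mem_nhds fun a => rfl) fun g hg => ?_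
  have : (fun a => g • y a) = fun a => g₀ • y a := funext hg
  change P _
  rw [this]
  exact hg₀

variable (Γ : Subgroup PGL(3, F))

omit [TopologicalSpace F] [IsNonarchimedeanLocalField F] in
theorem mk_smul_vertex (g : GL (Fin 3) F) (x : Vertex F) :
    Matrix.ProjGenLinGroup.mk g • x = g • x := rfl

omit [ValuativeRel F] [IsNonarchimedeanLocalField F] in
theorem isOpen_PGL_iff {U : Set PGL(3, F)} : IsOpen U ↔
    IsOpen ((Matrix.ProjGenLinGroup.mk : GL (Fin 3) F →* PGL(3, F)) ⁻¹' U) := Iff.rfl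

omit [ValuativeRel F] [IsNonarchimedeanLocalField F] in
theorem continuous_PGL_mk  :
    Continuous (Matrix.ProjGenLinGroup.mk : GL (Fin 3) F →* PGL(3, F)) := continuous_coinduced_rng

/-- A locally constant map on a compact space has finite range. Since the quotient is by left cosets
`g Γ`, the map sends `g Γ` to the `Γ`-orbit of `g⁻¹ [𝒪³]`. -/
theorem finite_qVertex [CompactSpace (PGL(3, F) ⧸ Γ)] : Finite (QVertex Γ) := by
  let φ : PGL(3, F) ⧸ Γ → QVertex Γ := Quotient.lift
    (fun g => Quotient.mk (MulAction.orbitRel Γ (Vertex F)) (g⁻¹ • origin F)) (by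
      intro a b hab
      have hab := QuotientGroup.leftRel_apply.1 hab
      refine Quotient.sound ⟨⟨a⁻¹ * b, hab⟩, ?_⟩
      change (a⁻¹ * b) • b⁻¹ • origin F = a⁻¹ • origin F
      rw [smul_smul, mul_inv_cancel_right])
  have hloc : IsLocallyConstant φ := by
    intro s
    refine (QuotientGroup.isQuotientMap_mk (N := Γ)).isOpen_preimage.1 ?_
    rw [isOpen_PGL_iff]
    have : IsOpen {g : GL (Fin 3) F |
        Quotient.mk (MulAction.orbitRel Γ (Vertex F)) (g • origin F) ∈ s} :=
      isOpen_setOf_smul (α := Unit) (fun _ => origin F)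
        fun f => Quotient.mk (MulAction.orbitRel Γ (Vertex F)) (f ()) ∈ s
    exact this.preimage continuous_inv
  have hsurj : Function.Surjective φ := by
    intro v
    induction v using Quotient.inductionOn with
    | h x =>
      obtain ⟨g, rfl⟩ := exists_smul_origin x
      refine ⟨QuotientGroup.mk (Matrix.ProjGenLinGroup.mk g)⁻¹, ?_⟩
      change Quotient.mk _ (((Matrix.ProjGenLinGroup.mk g)⁻¹)⁻¹ • origin F) = _
      rw [inv_inv]
      rfl
  have hr := hloc.range_finite
  rw [hsurj.range_eq] at hr
  exact Set.finite_univ_iff.1 hr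

/-- A torsion-free discrete group acts freely on the vertices. -/
theorem eq_one_of_smul_eq [DiscreteTopology Γ] (htf : ∀ γ ∈ Γ, IsOfFinOrder γ → γ = 1)
    {γ : PGL(3, F)} (hγ : γ ∈ Γ) {x : Vertex F} (hx : γ • x = x) : γ = 1 := by
  refine htf γ hγ ?_
  obtain ⟨h, rfl⟩ := exists_smul_origin x
  obtain ⟨g, rfl⟩ := Matrix.ProjGenLinGroup.mk_surjective γ
  rw [mk_smul_vertex, ← mul_smul] at hx
  obtain ⟨α, h1, h2⟩ := smul_origin_eq_iff.1 hx.symm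
  obtain ⟨Q, hQ⟩ := exists_inclGL_eq h1 h2
  -- `ψ` maps the compact group `GL₃(𝒪)` into the stabilizer of the vertex and sends the powers of
  -- `Q` to those of `γ`.
  let ψ : GL (Fin 3) 𝒪[F] → PGL(3, F) := fun P => Matrix.ProjGenLinGroup.mk (h * inclGL F P * h⁻¹)
  have hψ : Continuous ψ :=
    continuous_PGL_mk.comp ((continuous_const.mul continuous_inclGL).mul continuous_const)
  have hψQ : ∀ n : ℕ, ψ (Q ^ n) = Matrix.ProjGenLinGroup.mk g ^ n := by
    intro n
    have e : ψ Q = Matrix.ProjGenLinGroup.mk g := by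
      change Matrix.ProjGenLinGroup.mk (h * inclGL F Q * h⁻¹) = _
      rw [hQ, diagGL_const]
      simp only [map_mul, map_inv, Matrix.ProjGenLinGroup.mk_scalar, one_mul]
      group
    change Matrix.ProjGenLinGroup.mk (h * inclGL F (Q ^ n) * h⁻¹) = _
    rw [← e, ← map_pow, map_pow (inclGL F), conj_pow]
  obtain ⟨U, hU, hU1⟩ := isOpen_induced_iff.1 (isOpen_discrete ({1} : Set Γ))
  have hU1' : ∀ δ ∈ Γ, δ ∈ U → δ = 1 := by
    intro δ hδ hδU
    have : (⟨δ, hδ⟩ : Γ) ∈ Subtype.val ⁻¹' U := hδU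
    rw [hU1] at this
    exact congrArg Subtype.val this
  have h1U : (1 : PGL(3, F)) ∈ U := by
    have : (1 : Γ) ∈ Subtype.val ⁻¹' U := by
      rw [hU1]
      rfl
    exact this
  have hW : ψ ⁻¹' U ∈ nhds (1 : GL (Fin 3) 𝒪[F]) := by
    refine (hU.preimage hψ).mem_nhds ?_
    have : ψ 1 = 1 := by simpa using hψQ 0 |>.symm ▸ (by simp [ψ] : ψ 1 = 1)
    change ψ 1 ∈ U
    rwa [this]
  obtain ⟨V, hV, hVW⟩ := exists_nhds_split_inv hW
  have := compactSpace_integralGL F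
  obtain ⟨t, ht⟩ := CompactSpace.elim_nhds_subcover (fun a : GL (Fin 3) 𝒪[F] => {P | P / a ∈ V})
    (fun a => by
      have hc : Filter.Tendsto (fun P : GL (Fin 3) 𝒪[F] => P / a) (nhds a) (nhds 1) := by
        have : Continuous fun P : GL (Fin 3) 𝒪[F] => P / a := by fun_prop
        simpa using this.tendsto a
      exact hc hV)
  have hcov : ∀ n : ℕ, ∃ a : t, Q ^ n / a.1 ∈ V := by
    intro n
    have hn : Q ^ n ∈ ⋃ a ∈ t, {P | P / a ∈ V} := by
      rw [ht]
      trivial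
    simp only [Set.mem_iUnion] at hn
    obtain ⟨a, ha, hV⟩ := hn
    exact ⟨⟨a, ha⟩, hV⟩
  choose f hf using hcov
  -- Pigeonhole: two powers of `Q` lie in the same translate of `V`, so their quotient is mapped
  -- into `U`, which meets `Γ` only in 1.
  obtain ⟨m, n, hmn, hfmn⟩ := Finite.exists_ne_map_eq_of_infinite f
  wlog hlt : m < n generalizing m n
  · exact this n m hmn.symm hfmn.symm (by omega)
  have h3 := hVW _ (hf n) _ (hf m)
  rw [hfmn, div_div_div_cancel_right, div_eq_mul_inv, ← pow_sub Q hlt.le, Set.mem_preimage,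
    hψQ] at h3
  exact isOfFinOrder_iff_pow_eq_one.2 ⟨n - m, by omega, hU1' _ (Γ.pow_mem hγ _) h3⟩

end Topology

/-! ### Edges of the quotient and the matrix of `T` -/

section QuotientEdges

open scoped LinearAlgebra.Projectivization

variable {F : Type*} [Field F] [ValuativeRel F] {ϖ : Fˣ} (Γ : Subgroup PGL(3, F))

theorem qpair_eq_iff {x y x' y' : Vertex F} :
    qpair Γ x y = qpair Γ x' y' ↔ ∃ γ ∈ Γ, γ • x' = x ∧ γ • y' = y := by
  rw [qpair, qpair, Quotient.eq]
  change (x, y) ∈ MulAction.orbit Γ (x', y') ↔ _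
  constructor
  · rintro ⟨γ, h⟩
    exact ⟨γ.1, γ.2, congrArg Prod.fst h, congrArg Prod.snd h⟩
  · rintro ⟨γ, hγ, rfl, rfl⟩
    exact ⟨⟨γ, hγ⟩, rfl⟩

/-- The orbit of a vertex. -/
def qvertex (x : Vertex F) : QVertex Γ := Quotient.mk (MulAction.orbitRel Γ _) x

theorem qvertex_eq_iff {x x' : Vertex F} :
    qvertex Γ x = qvertex Γ x' ↔ ∃ γ ∈ Γ, γ • x' = x := by
  rw [qvertex, qvertex, Quotient.eq]
  change x ∈ MulAction.orbit Γ x' ↔ _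
  constructor
  · rintro ⟨γ, h⟩
    exact ⟨γ.1, γ.2, h⟩
  · rintro ⟨γ, hγ, rfl⟩
    exact ⟨⟨γ, hγ⟩, rfl⟩

/-- The starting point of an edge. -/
def QPair.fst : QPair Γ → QVertex Γ :=
  Quotient.map Prod.fst (by
    rintro _ p ⟨γ, rfl⟩
    exact ⟨γ, rfl⟩)

/-- The end point of an edge. -/
def QPair.snd : QPair Γ → QVertex Γ :=
  Quotient.map Prod.snd (by
    rintro _ p ⟨γ, rfl⟩
    exact ⟨γ, rfl⟩)

theorem fst_qpair (x y : Vertex F) : QPair.fst Γ (qpair Γ x y) = qvertex Γ x := rfl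

theorem snd_qpair (x y : Vertex F) : QPair.snd Γ (qpair Γ x y) = qvertex Γ y := rfl

theorem rev_qpair (x y : Vertex F) : QPair.rev Γ (qpair Γ x y) = qpair Γ y x := rfl

theorem exists_qvertex_eq [IsDiscreteValuationRing 𝒪[F]] (v : QVertex Γ) :
    ∃ g : GL (Fin 3) F, v = qvertex Γ (g • origin F) := by
  induction v using Quotient.inductionOn with
  | h x =>
    obtain ⟨g, rfl⟩ := exists_smul_origin x
    exact ⟨g, rfl⟩

variable {Γ} in
theorem line_smul {γ : PGL(3, F)} (g : GL (Fin 3) F) :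
    ∃ g' : GL (Fin 3) F, ∀ (ϖ : Fˣ) (k : ℤ), line ϖ g' k = γ • line ϖ g k := by
  obtain ⟨h, rfl⟩ := Matrix.ProjGenLinGroup.mk_surjective γ
  exact ⟨h * g, fun ϖ k => by rw [line_mul, mk_smul_vertex]⟩

variable [IsDiscreteValuationRing 𝒪[F]]

variable {Γ} in
theorem posAdj_of_qpair_eq (hϖ : IsUniformizer ϖ) {x y x' y' : Vertex F}
    (h : qpair Γ x y = qpair Γ x' y') (h' : PosAdj ϖ x' y') : PosAdj ϖ x y := by
  obtain ⟨γ, -, rfl, rfl⟩ := (qpair_eq_iff Γ).1 h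
  obtain ⟨g, rfl⟩ := Matrix.ProjGenLinGroup.mk_surjective γ
  exact h'.smul hϖ g

variable {Γ} in
theorem PosEdge.posAdj (hϖ : IsUniformizer ϖ) (e : PosEdge Γ ϖ) {x y : Vertex F}
    (h : e.1 = qpair Γ x y) : PosAdj ϖ x y := by
  obtain ⟨x', y', h1, h2⟩ := e.2
  exact posAdj_of_qpair_eq hϖ (h.symm.trans h2) h1

variable {Γ} in
/-- A rank-one geodesic with a positively oriented edge is a standard line. -/
theorem exists_line_of_posAdj (hϖ : IsUniformizer ϖ) {c : ℤ → Vertex F}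
    (hc : IsRankOneGeodesic ϖ c) {k : ℤ} (h : PosAdj ϖ (c k) (c (k + 1))) :
    ∃ g : GL (Fin 3) F, ∀ k, c k = line ϖ g k := by
  obtain ⟨g, hg | hg⟩ := (isRankOneGeodesic_iff hϖ c).1 hc
  · exact ⟨g, hg⟩
  · have := posAdj_line_succ hϖ g (-(k + 1))
    rw [neg_add, neg_add_cancel_right, ← neg_add, ← hg, ← hg] at this
    exact absurd this (h.asymm hϖ)

-- Orientation excludes the reversed lines in the definition of `Continues`; shifting the parameter
-- by one puts the common vertex at 0.
variable {Γ} in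
theorem continues_iff (hϖ : IsUniformizer ϖ) {e e' : PosEdge Γ ϖ} :
    Continues Γ ϖ e e' ↔ ∃ g : GL (Fin 3) F, e.1 = qpair Γ (line ϖ g (-1)) (line ϖ g 0) ∧
      e'.1 = qpair Γ (line ϖ g 0) (line ϖ g 1) := by
  constructor
  · rintro ⟨c, hc, h1, h2⟩
    obtain ⟨g, hg⟩ := exists_line_of_posAdj hϖ hc (k := 0) (e.posAdj hϖ h1)
    refine ⟨g * stepGL ϖ ^ (1 : ℤ), ?_, ?_⟩
    · rw [line_mul_stepGL_zpow, line_mul_stepGL_zpow, ← hg, ← hg]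
      exact h1
    · rw [line_mul_stepGL_zpow, line_mul_stepGL_zpow, ← hg, ← hg]
      exact h2
  · rintro ⟨g, h1, h2⟩
    refine ⟨line ϖ (g * stepGL ϖ ^ (-1 : ℤ)), (isRankOneGeodesic_iff hϖ _).2
      ⟨_, Or.inl fun _ => rfl⟩, ?_, ?_⟩
    · rw [line_mul_stepGL_zpow, line_mul_stepGL_zpow]
      exact h1
    · rw [line_mul_stepGL_zpow, line_mul_stepGL_zpow]
      exact h2

/-- The edges of `Γ \ X` that start at `[g 𝒪³]`. -/
def outEdge (hϖ : IsUniformizer ϖ) (g : GL (Fin 3) F) (w : ℙ 𝓀[F] (Fin 3 → 𝓀[F])) :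
    PosEdge Γ ϖ :=
  ⟨qpair Γ (g • origin F) (outVertex ϖ g w), _, _, (posAdj_smul_origin_iff hϖ g _).2 ⟨w, rfl⟩, rfl⟩

/-- The edges of `Γ \ X` that end at `[g 𝒪³]`. -/
def inEdge (hϖ : IsUniformizer ϖ) (g : GL (Fin 3) F) (p : ℙ 𝓀[F] (Fin 3 → 𝓀[F])) :
    PosEdge Γ ϖ :=
  ⟨qpair Γ (inVertex ϖ g p) (g • origin F), _, _, (posAdj_smul_origin_iff' hϖ g _).2 ⟨p, rfl⟩, rfl⟩

theorem exists_outEdge_eq (hϖ : IsUniformizer ϖ) (e : PosEdge Γ ϖ) (g : GL (Fin 3) F)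
    (h : QPair.fst Γ e.1 = qvertex Γ (g • origin F)) : ∃ w, outEdge Γ hϖ g w = e := by
  obtain ⟨x, y, h1, h2⟩ := e.2
  rw [h2, fst_qpair, eq_comm, qvertex_eq_iff] at h
  obtain ⟨γ, hγ, h⟩ := h
  have h3 : e.1 = qpair Γ (g • origin F) (γ • y) := by
    rw [h2, ← h, eq_comm, qpair_eq_iff]
    exact ⟨γ, hγ, rfl, rfl⟩
  obtain ⟨w, hw⟩ := (posAdj_smul_origin_iff hϖ g _).1 (e.posAdj hϖ h3)
  exact ⟨w, Subtype.ext (by rw [h3, hw]; rfl)⟩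

theorem exists_inEdge_eq (hϖ : IsUniformizer ϖ) (e : PosEdge Γ ϖ) (g : GL (Fin 3) F)
    (h : QPair.snd Γ e.1 = qvertex Γ (g • origin F)) : ∃ p, inEdge Γ hϖ g p = e := by
  obtain ⟨x, y, h1, h2⟩ := e.2
  rw [h2, snd_qpair, eq_comm, qvertex_eq_iff] at h
  obtain ⟨γ, hγ, h⟩ := h
  have h3 : e.1 = qpair Γ (γ • x) (g • origin F) := by
    rw [h2, ← h, eq_comm, qpair_eq_iff]
    exact ⟨γ, hγ, rfl, rfl⟩
  obtain ⟨w, hw⟩ := (posAdj_smul_origin_iff' hϖ g _).1 (e.posAdj hϖ h3)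
  exact ⟨w, Subtype.ext (by rw [h3, hw]; rfl)⟩

omit [IsDiscreteValuationRing 𝒪[F]] in
theorem Continues.snd_eq_fst {e e' : PosEdge Γ ϖ} (h : Continues Γ ϖ e e') :
    QPair.snd Γ e.1 = QPair.fst Γ e'.1 := by
  obtain ⟨c, -, h1, h2⟩ := h
  rw [h1, h2, snd_qpair, fst_qpair]

variable {Γ}

theorem outEdge_injective (hϖ : IsUniformizer ϖ)
    (hfree : ∀ γ ∈ Γ, ∀ x : Vertex F, γ • x = x → γ = 1) (g : GL (Fin 3) F) :
    Function.Injective (outEdge Γ hϖ g) := by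
  intro w w' h
  obtain ⟨γ, hγ, h1, h2⟩ := (qpair_eq_iff Γ).1 (congrArg Subtype.val h)
  rw [hfree γ hγ _ h1, one_smul] at h2
  exact outVertex_injective hϖ g h2.symm

theorem inEdge_injective (hϖ : IsUniformizer ϖ)
    (hfree : ∀ γ ∈ Γ, ∀ x : Vertex F, γ • x = x → γ = 1) (g : GL (Fin 3) F) :
    Function.Injective (inEdge Γ hϖ g) := by
  intro w w' h
  obtain ⟨γ, hγ, h1, h2⟩ := (qpair_eq_iff Γ).1 (congrArg Subtype.val h)
  rw [hfree γ hγ _ h2, one_smul] at h1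
  exact inVertex_injective hϖ g h1.symm

/-- The elements of `Γ` that lift the two edges agree at the common vertex, hence coincide by
freeness. Straightness in `Γ \ X` is therefore straightness in `X`. -/
theorem continues_inEdge_outEdge_iff (hϖ : IsUniformizer ϖ)
    (hfree : ∀ γ ∈ Γ, ∀ x : Vertex F, γ • x = x → γ = 1) (g : GL (Fin 3) F)
    (p w : ℙ 𝓀[F] (Fin 3 → 𝓀[F])) :
    Continues Γ ϖ (inEdge Γ hϖ g p) (outEdge Γ hϖ g w) ↔ ¬ p.orthogonal w := by
  rw [continues_iff hϖ, ← exists_line_iff hϖ g]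
  constructor
  · rintro ⟨h, h1, h2⟩
    obtain ⟨γ, hγ, h3, h4⟩ := (qpair_eq_iff Γ).1 h1
    obtain ⟨δ, hδ, h5, h6⟩ := (qpair_eq_iff Γ).1 h2
    obtain ⟨h', hh'⟩ := line_smul (γ := γ) h
    have e : δ⁻¹ * γ = 1 := by
      refine hfree _ (Γ.mul_mem (Γ.inv_mem hδ) hγ) (line ϖ h 0) ?_
      rw [mul_smul, h4, ← h5, inv_smul_smul]
    rw [← inv_mul_eq_one.1 e] at hh'
    have e' : δ = γ := inv_mul_eq_one.1 e
    exact ⟨h', by rw [hh', e', h3], by rw [hh', h5], by rw [hh', h6]⟩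
  · rintro ⟨h, h1, h2, h3⟩
    exact ⟨h, by rw [h1, h2]; rfl, by rw [h2, h3]; rfl⟩

theorem bijective_outEdge (hϖ : IsUniformizer ϖ)
    (hfree : ∀ γ ∈ Γ, ∀ x : Vertex F, γ • x = x → γ = 1) {r : QVertex Γ → GL (Fin 3) F}
    (hr : ∀ v, v = qvertex Γ (r v • origin F)) :
    Function.Bijective fun q : QVertex Γ × ℙ 𝓀[F] (Fin 3 → 𝓀[F]) => outEdge Γ hϖ (r q.1) q.2 := by
  constructor
  · rintro ⟨v, w⟩ ⟨v', w'⟩ h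
    have h1 : v = v' := by
      rw [hr v, hr v']
      exact congrArg (fun e : PosEdge Γ ϖ => QPair.fst Γ e.1) h
    subst h1
    exact congrArg (Prod.mk v) (outEdge_injective hϖ hfree _ h)
  · intro e
    obtain ⟨w, hw⟩ := exists_outEdge_eq Γ hϖ e (r (QPair.fst Γ e.1)) (hr _)
    exact ⟨⟨_, w⟩, hw⟩

variable [Finite 𝓀[F]]

theorem finite_posEdge (hϖ : IsUniformizer ϖ)
    (hfree : ∀ γ ∈ Γ, ∀ x : Vertex F, γ • x = x → γ = 1) [Finite (QVertex Γ)] :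
    Finite (PosEdge Γ ϖ) := by
  choose r hr using exists_qvertex_eq Γ
  exact Finite.of_surjective _ (bijective_outEdge hϖ hfree hr).2

theorem card_posEdge (hϖ : IsUniformizer ϖ)
    (hfree : ∀ γ ∈ Γ, ∀ x : Vertex F, γ • x = x → γ = 1) :
    Nat.card (PosEdge Γ ϖ) =
      (Nat.card 𝓀[F] ^ 2 + Nat.card 𝓀[F] + 1) * Nat.card (QVertex Γ) := by
  choose r hr using exists_qvertex_eq Γ
  rw [← Nat.card_eq_of_bijective _ (bijective_outEdge hϖ hfree hr), Nat.card_prod,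
    card_projectivePlane, mul_comm]

/-- The edge operator is invertible. -/
theorem det_relMatrix_continues_ne_zero (hϖ : IsUniformizer ϖ)
    (hfree : ∀ γ ∈ Γ, ∀ x : Vertex F, γ • x = x → γ = 1) [Fintype (PosEdge Γ ϖ)]
    [DecidableEq (PosEdge Γ ϖ)] : (relMatrix (Continues Γ ϖ)).det ≠ 0 := by
  classical
  rw [Ne, ← Matrix.exists_vecMul_eq_zero_iff]
  rintro ⟨f, hf0, hf⟩
  refine hf0 (funext fun e => ?_)
  obtain ⟨g, hg⟩ := exists_qvertex_eq Γ (QPair.snd Γ e.1)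
  obtain ⟨p, rfl⟩ := exists_inEdge_eq Γ hϖ e g hg
  have := Fintype.ofFinite (ℙ 𝓀[F] (Fin 3 → 𝓀[F]))
  -- Only edges ending at the start of `outEdge Γ hϖ g w` continue into it, so the kernel equation
  -- splits into one non-incidence system per vertex.
  refine congrFun (eq_zero_of_sum_not_orthogonal (fun p => f (inEdge Γ hϖ g p)) fun w => ?_) p
  have h := congrFun hf (outEdge Γ hϖ g w)
  rw [Matrix.vecMul, dotProduct, Pi.zero_apply] at h
  refine Eq.trans ?_ h
  refine Fintype.sum_of_injective _ (inEdge_injective hϖ hfree g) _ _ ?_ ?_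
  · intro e' he'
    have : ¬ Continues Γ ϖ e' (outEdge Γ hϖ g w) := fun hc =>
      he' (exists_inEdge_eq Γ hϖ e' g (hc.snd_eq_fst Γ))
    simp [relMatrix, this]
  · intro p'
    simp only [relMatrix, Matrix.of_apply, continues_inEdge_outEdge_iff hϖ hfree]
    split_ifs <;> simp_all

-- The coordinates of `T e` form the row of `e` in `relMatrix`, so `T` has the transposed matrix;
-- the determinant does not see this.
omit [IsDiscreteValuationRing 𝒪[F]] [Finite 𝓀[F]] in
theorem det_one_sub_smul_edgeOperator [Fintype (PosEdge Γ ϖ)] [DecidableEq (PosEdge Γ ϖ)] (u : ℂ) :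
    (relMatrix (Continues Γ ϖ)).charpolyRev.eval u = LinearMap.det (1 - u • edgeOperator Γ ϖ) := by
  classical
  have hM : LinearMap.toMatrix Finsupp.basisSingleOne Finsupp.basisSingleOne (edgeOperator Γ ϖ) =
      (relMatrix (Continues Γ ϖ)).transpose := by
    ext i j
    rw [LinearMap.toMatrix_apply, Finsupp.coe_basisSingleOne, edgeOperator,
      Finsupp.linearCombination_single, one_smul, finsum_mem_eq_finite_toFinset_sum _
      (Set.toFinite _)]
    simp [relMatrix, Finsupp.single_apply, Finsupp.finsetSum_apply]
  rw [← LinearMap.det_toMatrix (Finsupp.basisSingleOne (R := ℂ) (ι := PosEdge Γ ϖ)), map_sub,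
    map_smul, hM, Module.End.one_eq_id, LinearMap.toMatrix_id, ← Matrix.det_transpose,
    Matrix.charpolyRev, ← Polynomial.coe_evalRingHom, RingHom.map_det]
  congr 1
  ext i j
  simp only [Matrix.sub_apply, Matrix.transpose_apply, Matrix.one_apply, eq_comm,
    Matrix.smul_apply, smul_eq_mul, RingHom.mapMatrix_apply, Matrix.map_apply, map_sub,
    Polynomial.coe_evalRingHom]
  split_ifs <;> simp <;> exact mul_comm _ _

end QuotientEdges

/-! ### Lifting paths of arrows to geodesics -/

section LocalToGlobal

variable {F : Type*} [Field F] [ValuativeRel F] {ϖ : Fˣ} {Γ : Subgroup PGL(3, F)}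

/-- The image in `Γ \ X` of the `k`-th edge of a standard line. -/
def lineEdge (ϖ : Fˣ) (Γ : Subgroup PGL(3, F)) (g : GL (Fin 3) F) (k : ℤ) : QPair Γ :=
  qpair Γ (line ϖ g k) (line ϖ g (k + 1))

section DVR

variable [IsDiscreteValuationRing 𝒪[F]]

/-- An element of `Γ` moves the line that witnesses `Continues` onto the last edge of the given
line, where the two are spliced. -/
theorem exists_extend_right (hϖ : IsUniformizer ϖ) {e e' : PosEdge Γ ϖ} (h : Continues Γ ϖ e e')
    {g : GL (Fin 3) F} {n : ℤ} (hg : e.1 = lineEdge ϖ Γ g n) :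
    ∃ g' : GL (Fin 3) F, (∀ k ≤ n + 1, line ϖ g' k = line ϖ g k) ∧
      e'.1 = lineEdge ϖ Γ g' (n + 1) := by
  obtain ⟨h₀, h1, h2⟩ := (continues_iff hϖ).1 h
  obtain ⟨γ, hγ, h3, h4⟩ := (qpair_eq_iff Γ).1 (hg.symm.trans h1)
  obtain ⟨h', hh'⟩ := line_smul (γ := γ) h₀
  rw [← hh'] at h3 h4
  obtain ⟨g', hg1, hg2⟩ := exists_line_extend_right_at (g := g)
    (g' := h' * stepGL ϖ ^ (-(n + 1))) (n := n) hϖ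
    (by rw [line_mul_stepGL_zpow, ← h3]; congr 1; ring)
    (by rw [line_mul_stepGL_zpow, ← h4]; congr 1; ring)
  refine ⟨g', hg1, ?_⟩
  rw [h2, eq_comm, lineEdge, hg1 _ le_rfl, ← h4, show n + 1 + 1 = n + 2 by ring, hg2,
    line_mul_stepGL_zpow, show -(n + 1) + (n + 2) = 1 by ring, qpair_eq_iff]
  exact ⟨γ, hγ, (hh' _ _).symm, (hh' _ _).symm⟩

theorem exists_extend_left (hϖ : IsUniformizer ϖ) {e e' : PosEdge Γ ϖ} (h : Continues Γ ϖ e e')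
    {g : GL (Fin 3) F} {n : ℤ} (hg : e'.1 = lineEdge ϖ Γ g n) :
    ∃ g' : GL (Fin 3) F, (∀ k, n ≤ k → line ϖ g' k = line ϖ g k) ∧
      e.1 = lineEdge ϖ Γ g' (n - 1) := by
  obtain ⟨h₀, h1, h2⟩ := (continues_iff hϖ).1 h
  obtain ⟨γ, hγ, h3, h4⟩ := (qpair_eq_iff Γ).1 (hg.symm.trans h2)
  obtain ⟨h', hh'⟩ := line_smul (γ := γ) h₀
  rw [← hh'] at h3 h4
  obtain ⟨g', hg1, hg2⟩ := exists_line_extend_left_at (g := g)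
    (g' := h' * stepGL ϖ ^ (-n)) (n := n) hϖ
    (by rw [line_mul_stepGL_zpow, ← h3]; congr 1; ring)
    (by rw [line_mul_stepGL_zpow, ← h4]; congr 1; ring)
  refine ⟨g', hg1, ?_⟩
  rw [h1, eq_comm, lineEdge, sub_add_cancel, hg1 _ le_rfl, ← h3, hg2,
    line_mul_stepGL_zpow, show -n + (n - 1) = -1 by ring, qpair_eq_iff]
  exact ⟨γ, hγ, (hh' _ _).symm, (hh' _ _).symm⟩

/-- All lifts pass through the same vertex at time 0. They are then given by `g₀ GL₃(𝒪)`, a compact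
set of parameters. -/
theorem exists_line_segment (hϖ : IsUniformizer ϖ) {p : ℤ → PosEdge Γ ϖ}
    (hp : ∀ k, Continues Γ ϖ (p k) (p (k + 1))) {g₀ : GL (Fin 3) F}
    (h₀ : (p 0).1 = lineEdge ϖ Γ g₀ 0) (m n : ℕ) :
    ∃ g : GL (Fin 3) F, g • origin F = g₀ • origin F ∧
      ∀ k : ℤ, -m ≤ k → k ≤ n → (p k).1 = lineEdge ϖ Γ g k := by
  induction n with
  | zero =>
    induction m with
    | zero =>
      refine ⟨g₀, rfl, fun k hk hk' => ?_⟩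
      obtain rfl : k = 0 := by
        push_cast at hk hk'
        omega
      exact h₀
    | succ m ih =>
      obtain ⟨g, hg0, hg⟩ := ih
      have hc := hp (-(m : ℤ) - 1)
      rw [sub_add_cancel] at hc
      obtain ⟨g', h1, h2⟩ := exists_extend_left hϖ hc (hg (-m) le_rfl (by push_cast; omega))
      refine ⟨g', ?_, fun k hk hk' => ?_⟩
      · rw [← hg0, ← line_zero (ϖ := ϖ), ← line_zero (ϖ := ϖ), h1 0 (by omega)]
      · push_cast at hk
        rcases eq_or_lt_of_le hk with h | h
        · obtain rfl : k = -(m : ℤ) - 1 := by omega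
          exact h2
        · rw [hg k (by omega) hk', lineEdge, lineEdge, h1 k (by omega), h1 (k + 1) (by omega)]
  | succ n ih =>
    obtain ⟨g, hg0, hg⟩ := ih
    obtain ⟨g', h1, h2⟩ := exists_extend_right hϖ (hp n) (hg n (by omega) le_rfl)
    refine ⟨g', ?_, fun k hk hk' => ?_⟩
    · rw [← hg0, ← line_zero (ϖ := ϖ), ← line_zero (ϖ := ϖ), h1 0 (by omega)]
    · push_cast at hk'
      rcases eq_or_lt_of_le hk' with h | h
      · obtain rfl : k = (n : ℤ) + 1 := by omega
        exact h2
      · rw [hg k hk (by omega), lineEdge, lineEdge, h1 k (by omega), h1 (k + 1) (by omega)]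

end DVR

variable [TopologicalSpace F] [IsNonarchimedeanLocalField F]

theorem isClosed_lineEdge_eq (k : ℤ) (e : QPair Γ) :
    IsClosed {g : GL (Fin 3) F | lineEdge ϖ Γ g k = e} := by
  rw [← isOpen_compl_iff]
  have := isOpen_setOf_smul (F := F) (α := Bool)
    (fun a => cond a (stepGL ϖ ^ k • origin F) (stepGL ϖ ^ (k + 1) • origin F))
    fun f => qpair Γ (f true) (f false) ≠ e
  simp only [cond_true, cond_false, ← mul_smul] at this
  exact this

/-- A path of consecutive straight edges in `Γ \ X` is the image of a rank-one geodesic. -/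
theorem exists_line_of_continues (hϖ : IsUniformizer ϖ) {p : ℤ → PosEdge Γ ϖ}
    (hp : ∀ k, Continues Γ ϖ (p k) (p (k + 1))) :
    ∃ g : GL (Fin 3) F, ∀ k, (p k).1 = lineEdge ϖ Γ g k := by
  obtain ⟨g₀, h₀⟩ : ∃ g₀ : GL (Fin 3) F, (p 0).1 = lineEdge ϖ Γ g₀ 0 := by
    obtain ⟨x, y, h1, h2⟩ := (p 0).2
    obtain ⟨g, rfl, rfl⟩ := (posAdj_iff hϖ).1 h1
    exact ⟨g, by rw [h2, lineEdge, line_zero, zero_add, line, zpow_one]⟩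
  -- The parameters of the lines that lift the path on `[-n, n]`: a decreasing sequence of nonempty
  -- compact sets.
  let C : ℕ → Set (GL (Fin 3) 𝒪[F]) := fun n =>
    {Q | ∀ k : ℤ, -n ≤ k → k ≤ n → lineEdge ϖ Γ (g₀ * inclGL F Q) k = (p k).1}
  have hclosed : ∀ n, IsClosed (C n) := by
    intro n
    simp only [C, Set.ofPred_forall]
    refine isClosed_iInter fun k => isClosed_iInter fun _ => isClosed_iInter fun _ => ?_
    exact (isClosed_lineEdge_eq k (p k).1).preimage (continuous_const.mul continuous_inclGL)
  have := compactSpace_integralGL F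
  obtain ⟨Q, hQ⟩ := IsCompact.nonempty_iInter_of_sequence_nonempty_isCompact_isClosed C
    (fun n Q hQ k h1 h2 => hQ k (by push_cast; omega) (by push_cast; omega))
    (fun n => by
      obtain ⟨g, hg0, hg⟩ := exists_line_segment hϖ hp h₀ n n
      obtain ⟨Q, hQ⟩ := exists_inclGL_of_smul_origin_eq hg0.symm
      refine ⟨Q, fun k h1 h2 => ?_⟩
      rw [hg k h1 h2, lineEdge, lineEdge, hQ, hQ])
    (hclosed 0).isCompact hclosed
  refine ⟨g₀ * inclGL F Q, fun k => ?_⟩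
  exact (Set.mem_iInter.1 hQ k.natAbs k (by omega) (by omega)).symm

end LocalToGlobal

/-! ### Positive representatives of closed geodesics -/

section Geodesics

variable {F : Type*} [Field F] [ValuativeRel F] {ϖ : Fˣ} {Γ : Subgroup PGL(3, F)}

theorem rev_injective : Function.Injective (QPair.rev Γ) :=
  Function.LeftInverse.injective (QPair.rev_rev Γ)

variable [IsDiscreteValuationRing 𝒪[F]]

/-- The `k`-th edge of a standard line, as a positively oriented edge. -/
def linePosEdge (hϖ : IsUniformizer ϖ) (g : GL (Fin 3) F) (k : ℤ) : PosEdge Γ ϖ :=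
  ⟨lineEdge ϖ Γ g k, _, _, posAdj_line_succ hϖ g k, rfl⟩

theorem continues_linePosEdge (hϖ : IsUniformizer ϖ) (g : GL (Fin 3) F) (k : ℤ) :
    Continues Γ ϖ (linePosEdge hϖ g k) (linePosEdge hϖ g (k + 1)) := by
  refine (continues_iff hϖ).2 ⟨g * stepGL ϖ ^ (k + 1), ?_, ?_⟩
  · simp only [line_mul_stepGL_zpow, linePosEdge, lineEdge, add_neg_cancel_right, add_zero]
  · simp only [line_mul_stepGL_zpow, linePosEdge, lineEdge, add_zero]

theorem rev_ne (hϖ : IsUniformizer ϖ) (e e' : PosEdge Γ ϖ) : e'.1 ≠ QPair.rev Γ e.1 := by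
  intro h
  obtain ⟨x, y, h1, h2⟩ := e.2
  rw [h2, rev_qpair] at h
  exact h1.asymm hϖ (e'.posAdj hϖ h)

/-- Every class of primitive closed geodesics contains a positively oriented one. -/
theorem exists_positive_representative (hϖ : IsUniformizer ϖ) (x : PrimitiveGeodesic Γ ϖ) :
    ∃ (c : {c : ClosedGeodesic Γ ϖ // c.IsPrimitive}) (g : GL (Fin 3) F),
      Quotient.mk (geodesicSetoid Γ ϖ) c = x ∧ ∀ k, c.1.path k = lineEdge ϖ Γ g k := by
  induction x using Quotient.inductionOn with
  | h c =>
    obtain ⟨d, hd, hdc⟩ := c.1.isGeodesic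
    obtain ⟨g, hg | hg⟩ := (isRankOneGeodesic_iff hϖ d).1 hd
    · exact ⟨c, g, rfl, fun k => by rw [hdc, hg, hg, lineEdge]⟩
    -- Edge `k` joins the vertices `k` and `k + 1`, so reversing the line `k ↦ -k` sends edge `k` to
    -- edge `-1 - k`.
    · have hpath : ∀ k, QPair.rev Γ (c.1.path (-1 - k)) = lineEdge ϖ Γ g k := by
        intro k
        rw [hdc, rev_qpair, hg, hg, lineEdge]
        congr 2 <;> ring
      have hper : ∀ n : ℕ, Function.Periodic (lineEdge ϖ Γ g) (n : ℤ) ↔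
          Function.Periodic c.1.path (n : ℤ) := by
        intro n
        constructor
        · intro h k
          have := h (-1 - k - n)
          rw [sub_add_cancel, ← hpath, ← hpath] at this
          have := rev_injective this
          rw [show -1 - (-1 - k) = k by ring, show -1 - (-1 - k - n) = k + n by ring] at this
          exact this.symm
        · intro h k
          rw [← hpath, ← hpath]
          have := h (-1 - (k + n))
          rw [show -1 - (k + n) + n = -1 - k by ring] at this
          rw [this]
      let c' : ClosedGeodesic Γ ϖ :=
        { path := lineEdge ϖ Γ g
          length := c.1.length
          isGeodesic := ⟨line ϖ g, (isRankOneGeodesic_iff hϖ _).2 ⟨g, Or.inl fun _ => rfl⟩,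
            fun _ => rfl⟩
          length_pos := c.1.length_pos
          periodic := (hper _).2 c.1.periodic }
      refine ⟨⟨c', fun n hn h => c.2 n hn ((hper n).1 h)⟩, g, Quotient.sound ?_, fun _ => rfl⟩
      refine ⟨rfl, Or.inr ⟨-1, fun k => ?_⟩⟩
      change c.1.path k = QPair.rev Γ (lineEdge ϖ Γ g (-1 - k))
      rw [← hpath, QPair.rev_rev]
      congr 1
      ring

end Geodesics

/-! ### The Euler product and the theorem -/

section Zeta

variable {F : Type*} [Field F] [ValuativeRel F] [TopologicalSpace F]
  [IsNonarchimedeanLocalField F] {ϖ : Fˣ} {Γ : Subgroup PGL(3, F)}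

/-- The Euler product formula: `∏ (1 - u ^ l(c)) = det (1 - u T)`. -/
theorem hasProd_eulerFactor (hϖ : IsUniformizer ϖ) [Fintype (PosEdge Γ ϖ)]
    [DecidableEq (PosEdge Γ ϖ)] :
    HasProd (eulerFactor Γ ϖ) ((relMatrix (Continues Γ ϖ)).charpolyRev : ℂ⟦X⟧) := by
  choose c g hc hg using exists_positive_representative (Γ := Γ) hϖ
  have hlen : ∀ x, (c x).1.length = x.length := fun x => by
    conv_rhs => rw [← hc x]
    rfl
  have hper : ∀ x (n : ℕ), Function.Periodic (fun k => linePosEdge (Γ := Γ) hϖ (g x) k) (n : ℤ) ↔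
      Function.Periodic (c x).1.path (n : ℤ) := by
    intro x n
    refine forall_congr' fun k => ?_
    rw [hg, hg]
    exact Subtype.ext_iff
  have key := hasProd_primitive_orbits (Continues Γ ϖ) (fun x : PrimitiveGeodesic Γ ϖ => x.length)
    (fun x k => linePosEdge hϖ (g x) k)
  have hcont := fun x k => continues_linePosEdge (Γ := Γ) hϖ (g x) k
  refine key ?_ hcont ?_ ?_ ?_ ?_
  · intro x
    rw [← hlen]
    exact (c x).1.length_pos
  · intro x
    rw [← hlen, hper]
    exact (c x).1.periodic
  · intro x n hn h
    rw [← hlen]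
    exact (c x).2 n hn ((hper x n).1 h)
  · intro x y j h
    have hpath : ∀ k, (c y).1.path k = (c x).1.path (k + j) := by
      intro k
      rw [hg, hg]
      exact congrArg Subtype.val (h k)
    have hpath' : ∀ k, (c x).1.path k = (c y).1.path (k - j) := by
      intro k
      rw [hpath, sub_add_cancel]
    rw [← hc x, ← hc y]
    -- The lengths agree because both are minimal periods of paths that differ by a shift.
    refine Quotient.sound ⟨le_antisymm ?_ ?_, Or.inl ⟨j, hpath⟩⟩
    · refine (c x).2 _ (c y).1.length_pos fun k => ?_
      rw [hpath', hpath', add_sub_right_comm]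
      exact (c y).1.periodic _
    · refine (c y).2 _ (c x).1.length_pos fun k => ?_
      rw [hpath, hpath, add_right_comm]
      exact (c x).1.periodic _
  · intro p n hn hp hpn
    obtain ⟨h, hh⟩ := exists_line_of_continues hϖ hp
    classical
    have hex : ∃ m : ℕ, 0 < m ∧ Function.Periodic p (m : ℤ) := ⟨n, hn, hpn⟩
    have hper' : ∀ m : ℕ, Function.Periodic (fun k => (p k).1) (m : ℤ) ↔
        Function.Periodic p (m : ℤ) := fun m => forall_congr' fun k => Subtype.ext_iff.symm
    -- The lifted path with its least period, which need not be the given `n`, is a primitive closed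
    -- geodesic.
    let d : ClosedGeodesic Γ ϖ :=
      { path := fun k => (p k).1
        length := Nat.find hex
        isGeodesic := ⟨line ϖ h, (isRankOneGeodesic_iff hϖ _).2 ⟨h, Or.inl fun _ => rfl⟩, hh⟩
        length_pos := (Nat.find_spec hex).1
        periodic := (hper' _).2 (Nat.find_spec hex).2 }
    have hd : d.IsPrimitive := fun m hm h => Nat.find_min' hex ⟨hm, (hper' m).1 h⟩
    refine ⟨Quotient.mk (geodesicSetoid Γ ϖ) ⟨d, hd⟩, ?_⟩
    set x : PrimitiveGeodesic Γ ϖ := Quotient.mk (geodesicSetoid Γ ϖ) ⟨d, hd⟩ with hx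
    -- The chosen representative and `d` both have positive edges, which leaves only the shift.
    obtain ⟨-, ⟨j, hj⟩ | ⟨j, hj⟩⟩ := Quotient.exact ((hc x).trans hx)
    · refine ⟨j, fun k => Subtype.ext ?_⟩
      exact (hj k).trans (hg x _)
    · have h0 := hj 0
      rw [hg] at h0
      exact absurd h0 (rev_ne hϖ (linePosEdge hϖ (g x) (j - 0)) (p 0))

end Zeta

end PGL3Building

end

theorem mainTheorem3 {F : Type*} [Field F] [ValuativeRel F] [TopologicalSpace F]
    [IsNonarchimedeanLocalField F] (ϖ : Fˣ) (hϖ : IsUniformizer ϖ)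
    (Γ : Subgroup PGL(3, F)) (hdiscrete : DiscreteTopology Γ)
    (hcocompact : CompactSpace (PGL(3, F) ⧸ Γ))
    (htorsionFree : ∀ γ ∈ Γ, IsOfFinOrder γ → γ = 1) :
    Finite (QVertex Γ) ∧ Finite (PosEdge Γ ϖ) ∧
    Multipliable (eulerFactor Γ ϖ) ∧
    ∃ P : ℂ[X],
      (∀ u : ℂ, P.eval u = LinearMap.det (1 - u • edgeOperator Γ ϖ)) ∧
      Z₁ Γ ϖ = (P : ℂ⟦X⟧) ∧
      P.natDegree = Nat.card (PosEdge Γ ϖ) ∧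
      Nat.card (PosEdge Γ ϖ) =
        (Nat.card 𝓀[F] ^ 2 + Nat.card 𝓀[F] + 1) * Nat.card (QVertex Γ) := by
  classical
  have hfree : ∀ γ ∈ Γ, ∀ x : Vertex F, γ • x = x → γ = 1 := fun γ hγ x hx =>
    eq_one_of_smul_eq Γ htorsionFree hγ hx
  have hV : Finite (QVertex Γ) := finite_qVertex Γ
  have hE : Finite (PosEdge Γ ϖ) := finite_posEdge hϖ hfree
  have := Fintype.ofFinite (PosEdge Γ ϖ)
  have hprod := hasProd_eulerFactor (Γ := Γ) hϖ
  refine ⟨hV, hE, hprod.multipliable, (relMatrix (Continues Γ ϖ)).charpolyRev,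
    det_one_sub_smul_edgeOperator, hprod.tprod_eq, ?_, card_posEdge hϖ hfree⟩
  rw [natDegree_charpolyRev _ (det_relMatrix_continues_ne_zero hϖ hfree),
    Nat.card_eq_fintype_card]
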